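/- Let $\mathrm{Lie}[a,b]$ be the free Lie algebra over $\mathbb{Q}$ on $a,b$. For $i\ge 0$ let $\varepsilon_{2i}$ be the derivation of $\mathrm{Lie}[a,b]$ with $$\varepsilon_{2i}(a)=\mathrm{ad}(a)^{2i}(b),\qquad \varepsilon_{2i}(b)=\sum_{j=0}^{i-1}(-1)^j\bigl[\mathrm{ad}(a)^{j}(b),\mathrm{ad}(a)^{2i-1-j}(b)\bigr],$$ and let $\mathcal{E}\subset\mathrm{Der}\,\mathrm{Lie}[a,b]$ be the Lie subalgebra generated by the $\varepsilon_{2i}$, $i\ge 0$ (Pollack's Lie algebra). A mould is a family $A=(A_r)_{r\ge0}$ with $A_r\in\mathbb{Q}(u_1,\dots,u_r)$, and $\mathrm{ARI}$ is the space of moulds with $A_0=0$, with the bracket $$\mathrm{ari}(A,B)=\mathrm{arit}(B)\cdot A-\mathrm{arit}(A)\cdot B+\mathrm{mu}(A,B)-\mathrm{mu}(B,A),$$ where $\mathrm{mu}(A,B)(u_1,\dots,u_r)=\sum_{i=0}^rA(u_1,\dots,u_i)B(u_{i+1},\dots,u_r)$ and $$(\mathrm{arit}(B)\cdot A)(u_1,\dots,u_r)=\sum_{0\le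 k<l<r}A(u_1,\dots,u_k,u_{k+1}+\cdots+u_{l+1},u_{l+2},\dots,u_r)\,B(u_{k+1},\dots,u_l)-\sum_{1\le k<l\le r}A(u_1,\dots,u_{k-1},u_k+\cdots+u_l,u_{l+1},\dots,u_r)\,B(u_{k+1},\dots,u_l).$$ For $i\ge -1$ let $U_{2i}\in\mathrm{ARI}$ be the mould concentrated in depth $1$ with $U_{2i}(u_1)=u_1^{2i}$, and let $\mathcal{U}\subset\mathrm{ARI}$ be the Lie algebra generated by the $U_{2i}$, $i\ge -1$, under $\mathrm{ari}$, i.e. the smallest $\mathbb{Q}$-subspace containing them and closed under $\mathrm{ari}$. By Lazard elimination $\mathrm{Lie}[a,b]=\mathbb{Q}a\oplus\mathrm{Lie}[C_1,C_2,\dots]$, where $C_i=\mathrm{ad}(a)^{i-1}(b)$ and the second summand is the free Lie algebra on the $C_i$. Let $\mathrm{ma}:\mathrm{Lie}[C_1,C_2,\dots]\to\mathrm{ARI}$ be the linear map obtained by expanding in $\mathbb{Q}\langle C_1,C_2,\dots\rangle$ and sending $C_{i_1}\cdots C_{i_r}$ to $(-1)^{i_1+\cdots+i_r-r}u_1^{i_1-1}\cdots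 u_r^{i_r-1}$ in depth $r$. Let $\mathrm{Der}^0\mathrm{Lie}[a,b]$ be the space of derivations $D$ with $D([a,b])=0$ such that $D(a)$ has no linear term in $a$, and define $\Psi:\mathrm{Der}^0\mathrm{Lie}[a,b]\to\mathrm{ARI}$ by $$\Psi(D)(u_1,\dots,u_r)=\frac{\mathrm{ma}(D(a))(u_1,\dots,u_r)}{u_1\cdots u_r(u_1+\cdots+u_r)}\qquad(r\ge1).$$ Then for every $i\ge0$ we have $\varepsilon_{2i}\in\mathrm{Der}^0\mathrm{Lie}[a,b]$ and $\Psi(\varepsilon_{2i})=U_{2i-2}\in\mathcal{U}$. Moreover $\mathcal{E}\subset\mathrm{Der}^0\mathrm{Lie}[a,b]$, $\mathcal{U}$ is a Lie algebra under $\mathrm{ari}$, and $\Psi$ restricts to an isomorphism of Lie algebras $\mathcal{E}\simeq\mathcal{U}$. -/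

import Mathlib

noncomputable section

namespace EllipticMould

/-! ### Derivations of a free Lie algebra with prescribed values on the generators -/

/-- `L ⊕ tL` with `t² = 0`; the pair `(x, v)` stands for `x + t v`. -/
def Tangent (L : Type) : Type := L × L

def Tangent.mk {L : Type} (x v : L) : Tangent L := (x, v)

section Tangent

variable {L : Type} [LieRing L] [LieAlgebra ℚ L]

instance : AddCommGroup (Tangent L) := inferInstanceAs (AddCommGroup (L × L))

instance : Module ℚ (Tangent L) := inferInstanceAs (Module ℚ (L × L))

instance : Bracket (Tangent L) (Tangent L) where
  bracket x y := Tangent.mk ⁅x.1, y.1⁆ (⁅x.1, y.2⁆ + ⁅x.2, y.1⁆)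

theorem Tangent.fst_lie (x y : Tangent L) : (⁅x, y⁆ : Tangent L).1 = ⁅x.1, y.1⁆ := rfl

theorem Tangent.snd_lie (x y : Tangent L) :
    (⁅x, y⁆ : Tangent L).2 = ⁅x.1, y.2⁆ + ⁅x.2, y.1⁆ := rfl

theorem Tangent.fst_add (x y : Tangent L) : (x + y).1 = x.1 + y.1 := rfl

theorem Tangent.snd_add (x y : Tangent L) : (x + y).2 = x.2 + y.2 := rfl

theorem Tangent.fst_smul (c : ℚ) (x : Tangent L) : (c • x).1 = c • x.1 := rfl

theorem Tangent.snd_smul (c : ℚ) (x : Tangent L) : (c • x).2 = c • x.2 := rfl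

theorem Tangent.ext {x y : Tangent L} (h₁ : x.1 = y.1) (h₂ : x.2 = y.2) : x = y :=
  Prod.ext h₁ h₂

instance : LieRing (Tangent L) where
  add_lie x y z := by
    apply Tangent.ext
    · simp only [Tangent.fst_lie, Tangent.fst_add, add_lie]
    · simp only [Tangent.snd_lie, Tangent.fst_add, Tangent.snd_add, add_lie]; abel
  lie_add x y z := by
    apply Tangent.ext
    · simp only [Tangent.fst_lie, Tangent.fst_add, lie_add]
    · simp only [Tangent.snd_lie, Tangent.fst_add, Tangent.snd_add, lie_add]; abel
  lie_self x := by
    apply Tangent.ext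
    · exact lie_self x.1
    · change ⁅x.1, x.2⁆ + ⁅x.2, x.1⁆ = 0
      rw [← lie_skew x.1 x.2]; abel
  leibniz_lie x y z := by
    apply Tangent.ext
    · exact leibniz_lie x.1 y.1 z.1
    · simp only [Tangent.snd_lie, Tangent.fst_lie, Tangent.snd_add, lie_add, add_lie]
      rw [leibniz_lie x.1 y.1 z.2, leibniz_lie x.1 y.2 z.1, leibniz_lie x.2 y.1 z.1]
      abel

instance : LieAlgebra ℚ (Tangent L) where
  lie_smul t x y := by
    apply Tangent.ext
    · simp only [Tangent.fst_lie, Tangent.fst_smul, lie_smul]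
    · simp only [Tangent.snd_lie, Tangent.fst_smul, Tangent.snd_smul, lie_smul, smul_add]

end Tangent

section FreeDerivation

variable {X : Type}

/-- The Lie algebra morphism `P ↦ P + t D(P)` with `D(x) = f x` on the generators. -/
def tangentLift (f : X → FreeLieAlgebra ℚ X) :
    FreeLieAlgebra ℚ X →ₗ⁅ℚ⁆ Tangent (FreeLieAlgebra ℚ X) :=
  FreeLieAlgebra.lift ℚ fun x => Tangent.mk (FreeLieAlgebra.of ℚ x) (f x)

theorem tangentLift_fst (f : X → FreeLieAlgebra ℚ X) (P : FreeLieAlgebra ℚ X) :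
    (tangentLift f P).1 = P := by
  let p : Tangent (FreeLieAlgebra ℚ X) →ₗ⁅ℚ⁆ FreeLieAlgebra ℚ X :=
    { toFun := fun x => x.1
      map_add' := fun _ _ => rfl
      map_smul' := fun _ _ => rfl
      map_lie' := rfl }
  have h : p.comp (tangentLift f) = LieHom.id := by
    apply FreeLieAlgebra.hom_ext
    intro x
    rw [LieHom.comp_apply, tangentLift, FreeLieAlgebra.lift_of_apply]
    rfl
  exact LieHom.congr_fun h P

/-- The unique derivation of the free Lie algebra on `X` with `D(x) = f x` for `x ∈ X`. -/
def freeDerivation (f : X → FreeLieAlgebra ℚ X) :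
    LieDerivation ℚ (FreeLieAlgebra ℚ X) (FreeLieAlgebra ℚ X) where
  toFun P := (tangentLift f P).2
  map_add' P Q := by rw [map_add]; rfl
  map_smul' c P := by rw [map_smul]; rfl
  leibniz' P Q := by
    change (tangentLift f ⁅P, Q⁆).2 = ⁅P, (tangentLift f Q).2⁆ - ⁅Q, (tangentLift f P).2⁆
    rw [LieHom.map_lie, Tangent.snd_lie, tangentLift_fst, tangentLift_fst,
      ← lie_skew Q (tangentLift f P).2, sub_neg_eq_add]

theorem freeDerivation_of (f : X → FreeLieAlgebra ℚ X) (x : X) :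
    freeDerivation f (FreeLieAlgebra.of ℚ x) = f x := by
  change (tangentLift f (FreeLieAlgebra.of ℚ x)).2 = f x
  rw [tangentLift, FreeLieAlgebra.lift_of_apply]
  rfl

end FreeDerivation

/-! ### The free Lie algebra on `a, b` and Pollack's Lie algebra -/

inductive Letter : Type
  | a
  | b

/-- `Lie[a, b]` over `ℚ`. -/
abbrev LieAB : Type := FreeLieAlgebra ℚ Letter

def genA : LieAB := FreeLieAlgebra.of ℚ Letter.a

def genB : LieAB := FreeLieAlgebra.of ℚ Letter.b

/-- `Der Lie[a, b]`. -/
abbrev DerAB : Type := LieDerivation ℚ LieAB LieAB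

/-- `a ^ n · P = ad(a) ^ n (P)`. -/
def adA (n : ℕ) (P : LieAB) : LieAB := ((LieAlgebra.ad ℚ LieAB genA) ^ n) P

/-- The derivation `ε_{2i}`. -/
def eps (i : ℕ) : DerAB :=
  freeDerivation fun
    | Letter.a => adA (2 * i) genB
    | Letter.b => ∑ j ∈ Finset.range i, (-1 : ℚ) ^ j • ⁅adA j genB, adA (2 * i - 1 - j) genB⁆

/-- Pollack's Lie algebra: the Lie subalgebra of `Der Lie[a, b]` generated by the `ε_{2i}`,
`i ≥ 0`. -/
def pollack : LieSubalgebra ℚ DerAB := LieSubalgebra.lieSpan ℚ DerAB (Set.range eps)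

/-! ### Lazard elimination -/

/-- The free Lie algebra on `C₁, C₂, …`; the generator with index `n` is `C_{n+1}`. -/
abbrev LieC : Type := FreeLieAlgebra ℚ ℕ

/-- The derivation of `Lie[C₁, C₂, …]` with `C_i ↦ C_{i+1}`, that is, the action of `ad(a)`. -/
def shiftC : LieDerivation ℚ LieC LieC := freeDerivation fun n => FreeLieAlgebra.of ℚ (n + 1)

section Associative

attribute [local instance] LieRing.ofAssociativeRing

/-- The one-dimensional Lie algebra `ℚ a` acting on `Lie[C₁, C₂, …]`. -/
def shiftAction : ℚ →ₗ⁅ℚ⁆ LieDerivation ℚ LieC LieC where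
  toFun t := t • shiftC
  map_add' s t := add_smul s t shiftC
  map_smul' s t := mul_smul s t shiftC
  map_lie' := by
    intro s t
    have h : (⁅s, t⁆ : ℚ) = 0 := by rw [Ring.lie_def, mul_comm, sub_self]
    change (⁅s, t⁆ : ℚ) • shiftC = ⁅s • shiftC, t • shiftC⁆
    rw [h, zero_smul, smul_lie, lie_smul, lie_self, smul_zero, smul_zero]

/-- Lazard's isomorphism `Lie[a, b] = ℚ a ⊕ Lie[C₁, C₂, …]`, `C_i = ad(a)^{i-1}(b)`, where the
right-hand side is the semidirect sum in which `a` acts by `C_i ↦ C_{i+1}`. -/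
def lazard : LieAB →ₗ⁅ℚ⁆ LieAlgebra.SemiDirectSum LieC ℚ shiftAction :=
  FreeLieAlgebra.lift ℚ fun
    | Letter.a => ⟨0, 1⟩
    | Letter.b => ⟨FreeLieAlgebra.of ℚ 0, 0⟩

/-- The inclusion `Lie[C₁, C₂, …] → Lie[a, b]`, `C_i ↦ ad(a)^{i-1}(b)`. -/
def inclC : LieC →ₗ⁅ℚ⁆ LieAB := FreeLieAlgebra.lift ℚ fun n => adA n genB

theorem lazard_genA : lazard genA = ⟨0, 1⟩ := by
  rw [lazard, genA, FreeLieAlgebra.lift_of_apply]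

theorem lazard_adA (n : ℕ) : lazard (adA n genB) = ⟨FreeLieAlgebra.of ℚ n, 0⟩ := by
  induction n with
  | zero =>
    rw [adA, pow_zero, Module.End.one_apply, lazard, genB, FreeLieAlgebra.lift_of_apply]
  | succ n ih =>
    have h : adA (n + 1) genB = ⁅genA, adA n genB⁆ := by
      rw [adA, adA, pow_succ', Module.End.mul_apply, LieAlgebra.ad_apply]
    rw [h, LieHom.map_lie, ih, lazard_genA, LieAlgebra.SemiDirectSum.lie_eq_mk]
    have h1 : shiftAction 1 (FreeLieAlgebra.of ℚ n) = FreeLieAlgebra.of ℚ (n + 1) := by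
      change ((1 : ℚ) • shiftC) (FreeLieAlgebra.of ℚ n) = _
      rw [one_smul, shiftC, freeDerivation_of]
    simp [h1]

/-- `lazard` restricts to the identity on `Lie[C₁, C₂, …]`. -/
theorem lazard_inclC (Q : LieC) : lazard (inclC Q) = ⟨Q, 0⟩ := by
  have h : lazard.comp inclC = LieAlgebra.SemiDirectSum.inl shiftAction := by
    apply FreeLieAlgebra.hom_ext
    intro n
    rw [LieHom.comp_apply, inclC, FreeLieAlgebra.lift_of_apply, lazard_adA]
    rfl
  exact LieHom.congr_fun h Q

/-- The component of `P` in `Lie[C₁, C₂, …]`. -/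
def partC : LieAB →ₗ[ℚ] LieC :=
  (LieAlgebra.SemiDirectSum.projl shiftAction).comp lazard.toLinearMap

/-- The coefficient of the linear term in `a`. -/
def coeffA : LieAB →ₗ[ℚ] ℚ :=
  (LieAlgebra.SemiDirectSum.projr shiftAction).toLinearMap.comp lazard.toLinearMap

/-- `ℚ⟨C₁, C₂, …⟩`; the letter with index `n` is `C_{n+1}`. -/
abbrev PolyC : Type := MonoidAlgebra ℚ (FreeMonoid ℕ)

/-- The expansion of Lie polynomials, `Lie[C₁, C₂, …] → ℚ⟨C₁, C₂, …⟩`. -/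
def expandLieHom : LieC →ₗ⁅ℚ⁆ PolyC :=
  FreeLieAlgebra.lift ℚ fun n => MonoidAlgebra.single (FreeMonoid.of n) 1

/-- The linear map underlying `expandLieHom`. -/
def expandC : LieC →ₗ[ℚ] PolyC := expandLieHom.toLinearMap

end Associative

/-- The space of derivations killing `[a, b]` and whose value at `a` has no linear term
in `a`. -/
def derZero : Submodule ℚ DerAB where
  carrier := {D | D ⁅genA, genB⁆ = 0 ∧ coeffA (D genA) = 0}
  add_mem' := by
    rintro D E ⟨h₁, h₂⟩ ⟨h₃, h₄⟩
    refine ⟨?_, ?_⟩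
    · rw [LieDerivation.add_apply, h₁, h₃, add_zero]
    · rw [LieDerivation.add_apply, map_add, h₂, h₄, add_zero]
  zero_mem' := ⟨rfl, by rw [LieDerivation.zero_apply, map_zero]⟩
  smul_mem' := by
    rintro c D ⟨h₁, h₂⟩
    refine ⟨?_, ?_⟩
    · rw [LieDerivation.smul_apply, h₁, smul_zero]
    · rw [LieDerivation.smul_apply, map_smul, h₂, smul_zero]

/-! ### Moulds and the ari-bracket -/

/-- `ℚ(u₁, …, u_r)`. -/
def RatFun (r : ℕ) : Type := FractionRing (MvPolynomial (Fin r) ℚ)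

instance (r : ℕ) : Field (RatFun r) := inferInstanceAs (Field (FractionRing (MvPolynomial (Fin r) ℚ)))

instance (r : ℕ) : Algebra (MvPolynomial (Fin r) ℚ) (RatFun r) :=
  inferInstanceAs (Algebra (MvPolynomial (Fin r) ℚ) (FractionRing (MvPolynomial (Fin r) ℚ)))

instance (r : ℕ) : IsFractionRing (MvPolynomial (Fin r) ℚ) (RatFun r) :=
  inferInstanceAs
    (IsFractionRing (MvPolynomial (Fin r) ℚ) (FractionRing (MvPolynomial (Fin r) ℚ)))

instance (r : ℕ) : CharZero (RatFun r) :=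
  charZero_of_injective_algebraMap
    (IsFractionRing.injective (MvPolynomial (Fin r) ℚ) (RatFun r))

/-- The variable `u_{i+1}`. -/
def var {r : ℕ} (i : Fin r) : RatFun r :=
  algebraMap (MvPolynomial (Fin r) ℚ) (RatFun r) (MvPolynomial.X i)

/-- A (rational-function valued) mould `(A_r)_{r ≥ 0}`. -/
abbrev Mould : Type := ∀ r : ℕ, RatFun r

/-- The value of a rational function at a point with coordinates in a field; used below only at
points where the denominator does not vanish. -/
def evalRat {s : ℕ} {K : Type} [Field K] [Algebra ℚ K] (x : Fin s → K) (F : RatFun s) : K :=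
  MvPolynomial.aeval x (IsFractionRing.num (MvPolynomial (Fin s) ℚ) F) /
    MvPolynomial.aeval x (IsFractionRing.den (MvPolynomial (Fin s) ℚ) F : MvPolynomial (Fin s) ℚ)

/-- `A(w) = A_s(w₁, …, w_s)` for a word `w` of length `s`. -/
def atWord {K : Type} [Field K] [Algebra ℚ K] (A : Mould) (w : List K) : K :=
  evalRat w.get (A w.length)

/-- `a⌈c`: the sum of the letters of `b` is added to the first letter of `c`. -/
def flexLeft {K : Type} [Field K] (a b c : List K) : List K :=
  match c with
  | [] => a
  | x :: c' => a ++ (b.sum + x) :: c'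

/-- `a⌉c`: the sum of the letters of `b` is added to the last letter of `a`. -/
def flexRight {K : Type} [Field K] (a b c : List K) : List K :=
  match a.reverse with
  | [] => c
  | x :: a' => a'.reverse ++ (x + b.sum) :: c

/-- The word `(u₁, …, u_r)`. -/
def genericWord (r : ℕ) : List (RatFun r) := List.ofFn (var (r := r))

/-- `arit(B) · A`. In each term the word is cut as `a b c` with `a = (u₁, …, u_k)`,
`b = (u_{k+1}, …, u_l)`, `c = (u_{l+1}, …, u_r)`. -/
def arit (B A : Mould) : Mould := fun r =>
  (∑ k ∈ Finset.range r, ∑ l ∈ Finset.Ioo k r,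
    atWord A (flexLeft ((genericWord r).take k) (((genericWord r).take l).drop k)
      ((genericWord r).drop l)) * atWord B (((genericWord r).take l).drop k)) -
  ∑ k ∈ Finset.Icc 1 r, ∑ l ∈ Finset.Ioc k r,
    atWord A (flexRight ((genericWord r).take k) (((genericWord r).take l).drop k)
      ((genericWord r).drop l)) * atWord B (((genericWord r).take l).drop k)

/-- The product `mu(A, B)`. -/
def mu (A B : Mould) : Mould := fun r =>
  ∑ i ∈ Finset.range (r + 1),
    atWord A ((genericWord r).take i) * atWord B ((genericWord r).drop i)

def lu (A B : Mould) : Mould := mu A B - mu B A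

def ari (A B : Mould) : Mould := arit B A - arit A B + lu A B

/-- The space of moulds with `A(∅) = 0`. -/
def ARI : Submodule ℚ Mould where
  carrier := {A | A 0 = 0}
  add_mem' := by
    intro A B hA hB
    change A 0 + B 0 = 0
    rw [show A 0 = 0 from hA, show B 0 = 0 from hB, add_zero]
  zero_mem' := rfl
  smul_mem' := by
    intro c A hA
    change c • A 0 = 0
    rw [show A 0 = 0 from hA, smul_zero]

theorem ari_mem (A B : Mould) : ari A B ∈ ARI := by
  change ari A B 0 = 0
  have hg : genericWord 0 = [] := rfl
  simp only [ari, lu, Pi.add_apply, Pi.sub_apply, arit, mu, hg]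
  simp [mul_comm]

/-- The ari-bracket on `ARI`. -/
instance : Bracket ARI ARI where
  bracket A B := ⟨ari A B, ari_mem A B⟩

/-- The mould concentrated in depth `1` with value `u₁ ^ n`, `n ∈ ℤ`. -/
def mouldU (n : ℤ) : ARI where
  val := Pi.single 1 (var 0 ^ n)
  property := by
    change (Pi.single 1 (var 0 ^ n) : Mould) 0 = 0
    exact Pi.single_eq_of_ne (by decide) _

/-- `𝒰`: the smallest subspace of `ARI` which contains `U_{2i}` for all `i ≥ -1` and is closed
under the ari-bracket. -/
def algU : Submodule ℚ ARI :=
  sInf {V | (∀ i : ℤ, -1 ≤ i → mouldU (2 * i) ∈ V) ∧ ∀ A ∈ V, ∀ B ∈ V, ⁅A, B⁆ ∈ V}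

theorem algU_lie_mem {A B : ARI} (hA : A ∈ algU) (hB : B ∈ algU) : ⁅A, B⁆ ∈ algU := by
  rw [algU, Submodule.mem_sInf] at *
  intro V hV
  exact hV.2 A (hA V hV) B (hB V hV)

/-- The ari-bracket restricted to `𝒰`. -/
instance : Bracket algU algU where
  bracket A B := ⟨⁅(A : ARI), (B : ARI)⁆, algU_lie_mem A.2 B.2⟩

/-! ### The maps `ma`, `Δ⁻¹ ma` and `Ψ` -/

/-- `C_{i₁} ⋯ C_{i_r} ↦ (-1)^{i₁+⋯+i_r-r} u₁^{i₁-1} ⋯ u_r^{i_r-1}` in depth `r`; the letter with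
index `n` of the word `w` is `C_{n+1}`. -/
def maWord (w : List ℕ) : Mould :=
  Pi.single w.length ((-1) ^ w.sum * ∏ j : Fin w.length, var j ^ w.get j)

/-- `ma` on `ℚ⟨C₁, C₂, …⟩`. -/
def maPoly : PolyC →ₗ[ℚ] Mould :=
  (Finsupp.linearCombination ℚ fun w : FreeMonoid ℕ => maWord w.toList).comp
    (MonoidAlgebra.coeffLinearEquiv ℚ : PolyC ≃ₗ[ℚ] (FreeMonoid ℕ →₀ ℚ)).toLinearMap

/-- `ma` on `Lie[a, b]`, through the component in `Lie[C₁, C₂, …]`. -/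
def ma : LieAB →ₗ[ℚ] Mould := maPoly.comp (expandC.comp partC)

/-- `Δ_r = u₁ ⋯ u_r (u₁ + ⋯ + u_r)`. -/
def Delta (r : ℕ) : RatFun r := (∏ j : Fin r, var j) * ∑ j : Fin r, var j

/-- `Da(P)_r = ma(P)_r / Δ_r` for `r ≥ 1`. -/
def Da : LieAB →ₗ[ℚ] ARI where
  toFun P := ⟨fun r => if r = 0 then 0 else ma P r / Delta r, if_pos rfl⟩
  map_add' P Q := by
    apply Subtype.ext
    funext r
    change (if r = 0 then 0 else ma (P + Q) r / Delta r) =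
      (if r = 0 then 0 else ma P r / Delta r) + (if r = 0 then 0 else ma Q r / Delta r)
    split_ifs
    · rw [add_zero]
    · rw [map_add, Pi.add_apply, add_div]
  map_smul' c P := by
    apply Subtype.ext
    funext r
    change (if r = 0 then 0 else ma (c • P) r / Delta r) =
      c • (if r = 0 then 0 else ma P r / Delta r)
    split_ifs
    · rw [smul_zero]
    · rw [map_smul, Pi.smul_apply, div_eq_mul_inv, div_eq_mul_inv, smul_mul_assoc]

/-- `Ψ(D) = Da(D(a))` on derivations which kill `[a, b]` and whose value at `a` has no linear term
in `a`. -/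
def Psi : derZero →ₗ[ℚ] ARI where
  toFun D := Da ((D : DerAB) genA)
  map_add' D E := by
    rw [Submodule.coe_add, LieDerivation.add_apply, map_add]
  map_smul' c D := by
    rw [Submodule.coe_smul, LieDerivation.smul_apply, map_smul, RingHom.id_apply]

/-! ### Lie brackets on vector spaces -/

/-- The operation `⁅·, ·⁆` makes the `ℚ`-vector space `V` a Lie algebra. -/
structure IsLieAlgebra (V : Type) [AddCommGroup V] [Module ℚ V] [Bracket V V] : Prop where
  add_lie : ∀ x y z : V, ⁅x + y, z⁆ = ⁅x, z⁆ + ⁅y, z⁆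
  lie_add : ∀ x y z : V, ⁅x, y + z⁆ = ⁅x, y⁆ + ⁅x, z⁆
  smul_lie : ∀ (c : ℚ) (x y : V), ⁅c • x, y⁆ = c • ⁅x, y⁆
  lie_smul : ∀ (c : ℚ) (x y : V), ⁅x, c • y⁆ = c • ⁅x, y⁆
  lie_self : ∀ x : V, ⁅x, x⁆ = 0
  leibniz_lie : ∀ x y z : V, ⁅x, ⁅y, z⁆⁆ = ⁅⁅x, y⁆, z⁆ + ⁅y, ⁅x, z⁆⁆

end EllipticMould

end

/-!
Let `s` be an additive, nowhere vanishing map to a field from an alphabet which carries an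
addition. Evaluating the moulds along `s` turns `ari` into a bracket of noncommutative power series,
`ma(Q) / (u₁ ⋯ u_r)` into the image `Φ(Q)` of `Q` under a morphism of Lie algebras, and the division
by `u₁ + ⋯ + u_r` into the inversion of the derivation `∂` which multiplies the coefficient of a
word by the sum of the values of its letters. Thus `Ψ(D)` becomes the series `A` with
`∂A = Φ(D(a))`, and `ad(a)` becomes `-∂`.

A derivation `D` that kills `[a, b]` acts through `Φ` as `arat(A) = ad(A) - arit(A)`: the two have
the same commutator with `∂`, they both kill `C₂ = [a, b]`, which is sent to minus the sum of the
letters, and `∂` is injective on the series without constant term. Hence `Φ([D, E](a))` is `∂`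
applied to the series of `ari(Ψ(D), Ψ(E))`, which says that `Ψ` preserves brackets. It is injective
because `D(a)` determines `D` and the expansion of a free Lie algebra in the free associative
algebra is faithful, and it sends the generators `ε_{2i}` of `ℰ` to the generators `U_{2i-2}` of
`𝒰`.
-/

noncomputable section

namespace EllipticMould

attribute [local instance] LieRing.ofAssociativeRing

section LieDerivations

variable {R X L L' : Type*} [CommRing R] [LieRing L] [LieAlgebra R L] [LieRing L'] [LieAlgebra R L']

theorem lieSpan_range_freeLieAlgebra_of :
    LieSubalgebra.lieSpan R (FreeLieAlgebra R X) (Set.range (FreeLieAlgebra.of R)) = ⊤ := by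
  set S := LieSubalgebra.lieSpan R (FreeLieAlgebra R X) (Set.range (FreeLieAlgebra.of R))
  let toSpan : FreeLieAlgebra R X →ₗ⁅R⁆ S :=
    FreeLieAlgebra.lift R fun x => ⟨.of R x, LieSubalgebra.subset_lieSpan ⟨x, rfl⟩⟩
  have incl_toSpan : S.incl.comp toSpan = LieHom.id :=
    FreeLieAlgebra.hom_ext fun x => congrArg S.incl (FreeLieAlgebra.lift_of_apply _ x)
  refine eq_top_iff.2 fun P _ => ?_
  rw [← LieHom.id_apply (R := R) P, ← incl_toSpan]
  exact (toSpan P).2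

theorem map_lieDerivation_of_mem_lieSpan {s : Set L} {φ : L →ₗ⁅R⁆ L'} {D : LieDerivation R L L}
    {D' : LieDerivation R L' L'} (h : ∀ x ∈ s, φ (D x) = D' (φ x)) {x : L}
    (hx : x ∈ LieSubalgebra.lieSpan R L s) : φ (D x) = D' (φ x) := by
  induction hx using LieSubalgebra.lieSpan_induction with
  | mem x hx => exact h x hx
  | zero => simp only [map_zero]
  | add x y _ _ hx hy => simp only [map_add, hx, hy]
  | smul c x _ hx => simp only [map_smul, hx]
  | lie x y _ _ hx hy => simp only [LieDerivation.apply_lie_eq_add, map_add, LieHom.map_lie, hx, hy]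

theorem map_lieDerivation_freeLieAlgebra {φ : FreeLieAlgebra R X →ₗ⁅R⁆ L}
    {D : LieDerivation R (FreeLieAlgebra R X) (FreeLieAlgebra R X)} {D' : LieDerivation R L L}
    (h : ∀ x, φ (D (.of R x)) = D' (φ (.of R x))) (P : FreeLieAlgebra R X) :
    φ (D P) = D' (φ P) := by
  refine map_lieDerivation_of_mem_lieSpan (s := Set.range (FreeLieAlgebra.of R)) ?_ ?_
  · rintro _ ⟨x, rfl⟩
    exact h x
  · rw [lieSpan_range_freeLieAlgebra_of]
    trivial

theorem lie_mem_eigenspace_add {D : LieDerivation R L L} {c d : R} {x y : L}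
    (hx : x ∈ Module.End.eigenspace D.toLinearMap c)
    (hy : y ∈ Module.End.eigenspace D.toLinearMap d) :
    ⁅x, y⁆ ∈ Module.End.eigenspace D.toLinearMap (c + d) := by
  rw [Module.End.mem_eigenspace_iff, LieDerivation.coeFn_coe] at *
  rw [LieDerivation.apply_lie_eq_add, hx, hy, lie_smul, smul_lie, add_smul, add_comm]

end LieDerivations

section AffineRepresentation

variable {R L M : Type*} [CommRing R] [LieRing L] [LieAlgebra R L]
  [AddCommGroup M] [Module R M] [LieRingModule L M] [LieModule R L M]

/-- The representation `x · (m, t) = (x · m + t D(x), 0)` of `L` on `M × R` attached to a derivation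
`D : L → M`. -/
def affineRepresentation (D : LieDerivation R L M) : L →ₗ⁅R⁆ Module.End R (M × R) where
  toFun x := LinearMap.prod
    (LinearMap.coprod (LieModule.toEnd R L M x) (LinearMap.toSpanSingleton R M (D x))) 0
  map_add' x y := by
    ext <;> simp
  map_smul' c x := by
    ext <;> simp
  map_lie' {x y} := by
    ext <;> simp [Ring.lie_def]

theorem affineRepresentation_apply (D : LieDerivation R L M) (x : L) (z : M × R) :
    affineRepresentation D x z = (⁅x, z.1⁆ + z.2 • D x, 0) := by
  simp [affineRepresentation]

end AffineRepresentation

section EulerDerivation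

/-- The derivation of the free Lie algebra which multiplies a homogeneous element by its degree. -/
def eulerDerivation (X : Type) : LieDerivation ℚ (FreeLieAlgebra ℚ X) (FreeLieAlgebra ℚ X) :=
  freeDerivation (.of ℚ)

variable {X : Type}

theorem iSup_eigenspace_eulerDerivation_eq_top :
    ⨆ n : ℕ, Module.End.eigenspace (eulerDerivation X).toLinearMap (n + 1) = ⊤ := by
  set V : ℕ → Submodule ℚ (FreeLieAlgebra ℚ X) := fun n =>
    Module.End.eigenspace (eulerDerivation X).toLinearMap (n + 1)
  have lie_mem : ∀ P ∈ iSup V, ∀ Q ∈ iSup V, ⁅P, Q⁆ ∈ iSup V := by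
    refine (Submodule.map₂_le (f := (LieModule.toEnd ℚ _ (FreeLieAlgebra ℚ X)).toLinearMap)).1 ?_
    simp only [Submodule.map₂_iSup_left, Submodule.map₂_iSup_right, iSup_le_iff, Submodule.map₂_le]
    intro n m P hP Q hQ
    refine Submodule.mem_iSup_of_mem (m + n + 1) ?_
    have hPQ := lie_mem_eigenspace_add hP hQ
    rwa [show (m + 1 + (n + 1) : ℚ) = ((m + n + 1 : ℕ) : ℚ) + 1 by push_cast; ring] at hPQ
  let S : LieSubalgebra ℚ (FreeLieAlgebra ℚ X) :=
    { toSubmodule := iSup V, lie_mem' := fun {P Q} hP hQ => lie_mem P hP Q hQ }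
  have span_le : LieSubalgebra.lieSpan ℚ _ (Set.range (FreeLieAlgebra.of ℚ)) ≤ S := by
    refine LieSubalgebra.lieSpan_le.2 ?_
    rintro _ ⟨x, rfl⟩
    refine Submodule.mem_iSup_of_mem 0 (Module.End.mem_eigenspace_iff.2 ?_)
    rw [Nat.cast_zero, zero_add, one_smul]
    exact freeDerivation_of _ x
  rw [lieSpan_range_freeLieAlgebra_of] at span_le
  exact eq_top_iff.2 fun P _ => span_le trivial

theorem eulerDerivation_injective : Function.Injective (eulerDerivation X) := by
  refine (injective_iff_map_eq_zero (eulerDerivation X)).2 fun P hP => ?_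
  have disjoint := Module.End.eigenspaces_iSupIndep (eulerDerivation X).toLinearMap 0
  refine Submodule.disjoint_def.1 disjoint P (Module.End.mem_eigenspace_iff.2 ?_) ?_
  · rw [zero_smul]
    exact hP
  · have iSup_le_iSup : ⨆ n : ℕ, Module.End.eigenspace (eulerDerivation X).toLinearMap (n + 1) ≤
        ⨆ (c : ℚ) (_ : c ≠ 0), Module.End.eigenspace (eulerDerivation X).toLinearMap c :=
      iSup_le fun n => le_iSup₂_of_le (n + 1 : ℚ) (Nat.cast_add_one_ne_zero n) le_rfl
    rw [iSup_eigenspace_eulerDerivation_eq_top] at iSup_le_iSup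
    exact iSup_le_iSup trivial

-- Applied to `(0, 1)`, the affine representation attached to the Euler derivation recovers that
-- derivation; as it extends to the free associative algebra, no Poincaré–Birkhoff–Witt is needed.
theorem expandLieHom_injective : Function.Injective expandLieHom := by
  refine (injective_iff_map_eq_zero expandLieHom).2 fun P hP => ?_
  let ρ := affineRepresentation (eulerDerivation ℕ)
  let lifted : PolyC →ₐ[ℚ] Module.End ℚ (LieC × ℚ) :=
    MonoidAlgebra.lift ℚ _ _ (FreeMonoid.lift fun n => ρ (.of ℚ n))
  have lifted_comp : lifted.toLieHom.comp expandLieHom = ρ := by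
    refine FreeLieAlgebra.hom_ext fun n => ?_
    rw [LieHom.comp_apply, expandLieHom, FreeLieAlgebra.lift_of_apply]
    simp [lifted]
  have ρ_eq_zero : ρ P = 0 := by
    rw [← lifted_comp, LieHom.comp_apply, hP, map_zero]
  refine eulerDerivation_injective ?_
  have value := congrArg Prod.fst (LinearMap.congr_fun ρ_eq_zero (0, 1))
  simpa [ρ, affineRepresentation_apply] using value

end EulerDerivation

section Lazard

theorem adA_zero (P : LieAB) : adA 0 P = P := rfl

theorem adA_succ (n : ℕ) (P : LieAB) : adA (n + 1) P = ⁅genA, adA n P⁆ := by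
  rw [adA, adA, pow_succ', Module.End.mul_apply, LieAlgebra.ad_apply]

theorem shiftC_of (n : ℕ) : shiftC (.of ℚ n) = .of ℚ (n + 1) := freeDerivation_of _ n

theorem inclC_of (n : ℕ) : inclC (.of ℚ n) = adA n genB := FreeLieAlgebra.lift_of_apply _ n

theorem partC_inclC (Q : LieC) : partC (inclC Q) = Q := congrArg (·.left) (lazard_inclC Q)

theorem inclC_injective : Function.Injective inclC := Function.LeftInverse.injective partC_inclC

theorem partC_adA_genB (n : ℕ) : partC (adA n genB) = .of ℚ n := by rw [← inclC_of, partC_inclC]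

/-- The morphism of Lie algebras underlying `coeffA`. -/
def coeffALieHom : LieAB →ₗ⁅ℚ⁆ ℚ := (LieAlgebra.SemiDirectSum.projr shiftAction).comp lazard

theorem coeffALieHom_apply (P : LieAB) : coeffALieHom P = coeffA P := rfl

theorem coeffA_lie (P Q : LieAB) : coeffA ⁅P, Q⁆ = 0 := by
  rw [← coeffALieHom_apply, LieHom.map_lie, Ring.lie_def, mul_comm, sub_self]

theorem coeffA_adA_genB (n : ℕ) : coeffA (adA n genB) = 0 := congrArg (·.right) (lazard_adA n)

theorem genA_lie_inclC (Q : LieC) : ⁅genA, inclC Q⁆ = inclC (shiftC Q) := by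
  rw [← LieDerivation.ad_apply_apply ℚ]
  refine (map_lieDerivation_freeLieAlgebra (fun n => ?_) Q).symm
  rw [shiftC_of, inclC_of, inclC_of, adA_succ, LieDerivation.ad_apply_apply]

/-- The inverse `(Q, t) ↦ Q + t a` of Lazard's isomorphism. -/
def lazardInverse : LieAlgebra.SemiDirectSum LieC ℚ shiftAction →ₗ⁅ℚ⁆ LieAB where
  toFun z := inclC z.left + z.right • genA
  map_add' y z := by
    simp only [LieAlgebra.SemiDirectSum.add_eq_mk, map_add, add_smul]
    abel
  map_smul' c z := by
    simp only [LieAlgebra.SemiDirectSum.smul_eq_mk, map_smul, smul_add, smul_assoc,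
      RingHom.id_apply]
  map_lie' {y z} := by
    have shiftAction_apply (t : ℚ) (Q : LieC) : shiftAction t Q = t • shiftC Q := rfl
    simp only [LieAlgebra.SemiDirectSum.lie_eq_mk, map_add, map_sub, map_smul, LieHom.map_lie,
      shiftAction_apply, ← genA_lie_inclC, add_lie, lie_add, smul_lie, lie_smul, lie_self,
      Ring.lie_def, mul_comm z.right, sub_self, zero_smul, smul_zero, add_zero]
    rw [← lie_skew (inclC y.left) genA, smul_neg]
    abel

theorem lazardInverse_lazard (P : LieAB) : lazardInverse (lazard P) = P := by
  suffices lazardInverse.comp lazard = LieHom.id from LieHom.congr_fun this P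
  refine FreeLieAlgebra.hom_ext fun x => ?_
  cases x with
  | a =>
    change lazardInverse (lazard genA) = genA
    rw [lazard_genA]
    simp [lazardInverse]
  | b =>
    change lazardInverse (lazard (adA 0 genB)) = genB
    rw [lazard_adA]
    simp [lazardInverse, inclC_of, adA_zero]

theorem inclC_partC_add_smul_genA (P : LieAB) : inclC (partC P) + coeffA P • genA = P :=
  lazardInverse_lazard P

end Lazard

section Derivations

theorem coeffA_lieDerivation_apply {D : DerAB} (ha : coeffA (D genA) = 0)
    (hb : coeffA (D genB) = 0) (P : LieAB) : coeffA (D P) = 0 := by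
  refine map_lieDerivation_freeLieAlgebra (φ := coeffALieHom) (D' := 0) (fun x => ?_) P
  cases x
  exacts [ha, hb]

/-- The Lie algebra of the derivations which kill `[a, b]` and take their values in
`Lie[C₁, C₂, …]`. -/
def derLieC : LieSubalgebra ℚ DerAB where
  carrier := {D | D ⁅genA, genB⁆ = 0 ∧ ∀ P, coeffA (D P) = 0}
  add_mem' := fun {D E} hD hE =>
    ⟨by rw [LieDerivation.add_apply, hD.1, hE.1, add_zero],
      fun P => by rw [LieDerivation.add_apply, map_add, hD.2, hE.2, add_zero]⟩
  zero_mem' := ⟨rfl, fun _ => map_zero coeffA⟩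
  smul_mem' := fun c D hD =>
    ⟨by rw [LieDerivation.smul_apply, hD.1, smul_zero],
      fun P => by rw [LieDerivation.smul_apply, map_smul, hD.2, smul_zero]⟩
  lie_mem' := fun {D E} hD hE =>
    ⟨by rw [LieDerivation.lie_apply, hD.1, hE.1, map_zero, map_zero, sub_zero],
      fun P => by rw [LieDerivation.lie_apply, map_sub, hD.2, hE.2, sub_zero]⟩

theorem mem_derZero_of_mem_derLieC {D : DerAB} (hD : D ∈ derLieC) : D ∈ derZero :=
  ⟨hD.1, hD.2 genA⟩

theorem inclC_partC_apply {D : DerAB} (hD : D ∈ derLieC) (P : LieAB) :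
    inclC (partC (D P)) = D P := by
  simpa only [hD.2 P, zero_smul, add_zero] using inclC_partC_add_smul_genA (D P)

/-- The derivation of `Lie[C₁, C₂, …]` induced by a derivation of `Lie[a, b]`. -/
def inducedDerivation (D : DerAB) : LieDerivation ℚ LieC LieC :=
  freeDerivation fun n => partC (D (adA n genB))

theorem inclC_inducedDerivation {D : DerAB} (hD : D ∈ derLieC) (Q : LieC) :
    inclC (inducedDerivation D Q) = D (inclC Q) := by
  refine map_lieDerivation_freeLieAlgebra (fun n => ?_) Q
  rw [inducedDerivation, freeDerivation_of, inclC_of, inclC_partC_apply hD]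

theorem partC_apply_apply {D E : DerAB} (hD : D ∈ derLieC) (hE : E ∈ derLieC) (P : LieAB) :
    partC (D (E P)) = inducedDerivation D (partC (E P)) :=
  inclC_injective <| by
    rw [inclC_inducedDerivation hD, inclC_partC_apply hD, inclC_partC_apply hE]

theorem inducedDerivation_shiftC {D : DerAB} (hD : D ∈ derLieC) (Q : LieC) :
    inducedDerivation D (shiftC Q) = ⁅partC (D genA), Q⁆ + shiftC (inducedDerivation D Q) :=
  inclC_injective <| by
    rw [inclC_inducedDerivation hD, map_add, LieHom.map_lie, inclC_partC_apply hD,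
      ← genA_lie_inclC, ← genA_lie_inclC, inclC_inducedDerivation hD,
      LieDerivation.apply_lie_eq_add, add_comm]

theorem inducedDerivation_of_one {D : DerAB} (hD : D ∈ derLieC) :
    inducedDerivation D (.of ℚ 1) = 0 :=
  inclC_injective <| by
    rw [inclC_inducedDerivation hD, inclC_of, adA_succ, adA_zero, hD.1, map_zero]

end Derivations

section SumSplits

variable {α M : Type*} [AddCommMonoid M]

/-- The sum of `H a b` over the factorizations `w = a b` of a word. -/
def sumSplits (H : List α → List α → M) (w : List α) : M :=
  ∑ i ∈ Finset.range (w.length + 1), H (w.take i) (w.drop i)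

theorem sumSplits_nil (H : List α → List α → M) : sumSplits H [] = H [] [] := by
  simp [sumSplits]

theorem sumSplits_cons (H : List α → List α → M) (x : α) (w : List α) :
    sumSplits H (x :: w) = H [] (x :: w) + sumSplits (fun a b => H (x :: a) b) w := by
  rw [sumSplits, List.length_cons, Finset.sum_range_succ', add_comm]
  rfl

theorem sumSplits_congr {H H' : List α → List α → M} {w : List α}
    (h : ∀ a b, a ++ b = w → H a b = H' a b) : sumSplits H w = sumSplits H' w :=
  Finset.sum_congr rfl fun _ _ => h _ _ (List.take_append_drop _ w)

theorem sumSplits_add (H H' : List α → List α → M) (w : List α) :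
    sumSplits (fun a b => H a b + H' a b) w = sumSplits H w + sumSplits H' w :=
  Finset.sum_add_distrib

theorem sumSplits_zero (w : List α) : sumSplits (fun _ _ => (0 : M)) w = 0 :=
  Finset.sum_const_zero

theorem map_sumSplits {N F : Type*} [AddCommMonoid N] [FunLike F M N] [AddMonoidHomClass F M N]
    (φ : F) (H : List α → List α → M) (w : List α) :
    φ (sumSplits H w) = sumSplits (fun a b => φ (H a b)) w :=
  map_sum φ _ _

theorem sumSplits_map {β : Type*} (g : α → β) (H : List β → List β → M) (w : List α) :
    sumSplits H (w.map g) = sumSplits (fun a b => H (a.map g) (b.map g)) w := by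
  simp only [sumSplits, List.length_map, List.map_take, List.map_drop]

theorem sumSplits_sumSplits (H : List α → List α → List α → M) (w : List α) :
    sumSplits (fun u c => sumSplits (fun a b => H a b c) u) w =
      sumSplits (fun a u => sumSplits (fun b c => H a b c) u) w := by
  induction w generalizing H with
  | nil => simp only [sumSplits_nil]
  | cons x w ih => simp only [sumSplits_cons, sumSplits_nil, sumSplits_add, ih, add_assoc]

theorem sumSplits_comm {β : Type*} (H : List α → List α → List β → List β → M) (u : List α)
    (v : List β) : sumSplits (fun a b => sumSplits (H a b) v) u =
      sumSplits (fun c d => sumSplits (fun a b => H a b c d) u) v :=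
  Finset.sum_comm

theorem sumSplits_append_cons (H : List α → List α → M) (u : List α) (x : α) (v : List α) :
    sumSplits H (u ++ x :: v) =
      sumSplits (fun a b => H a (b ++ x :: v)) u + sumSplits (fun a b => H (u ++ x :: a) b) v := by
  induction u generalizing H with
  | nil => simp only [List.nil_append, sumSplits_cons, sumSplits_nil]
  | cons y u ih => simp only [List.cons_append, sumSplits_cons, ih, add_assoc]

theorem sumSplits_append_singleton (H : List α → List α → M) (u : List α) (x : α) :
    sumSplits H (u ++ [x]) = sumSplits (fun a b => H a (b ++ [x])) u + H (u ++ [x]) [] := by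
  rw [sumSplits_append_cons, sumSplits_nil]

theorem sumSplits_eq_nil_left {H : List α → List α → M} {w : List α}
    (h : ∀ x a b, H (x :: a) b = 0) : sumSplits H w = H [] w := by
  cases w with
  | nil => exact sumSplits_nil H
  | cons x w => simp only [sumSplits_cons, h, sumSplits_zero, add_zero]

theorem sumSplits_eq_nil_right {H : List α → List α → M} {w : List α}
    (h : ∀ a x b, H a (x :: b) = 0) : sumSplits H w = H w [] := by
  induction w generalizing H with
  | nil => exact sumSplits_nil H
  | cons x w ih => rw [sumSplits_cons, h, zero_add, ih fun a => h (x :: a)]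

theorem smul_sumSplits {R : Type*} [DistribSMul R M] (c : R) (H : List α → List α → M)
    (w : List α) : c • sumSplits H w = sumSplits (fun a b => c • H a b) w :=
  Finset.smul_sum

theorem sumSplits_cons_shift {H H' : List α → List α → M} (H_nil : ∀ a, H a [] = 0)
    (shift : ∀ a x b, H a (x :: b) = H' (a ++ [x]) b) (x : α) (w : List α) :
    sumSplits H (x :: w) = sumSplits (fun a b => H' (x :: a) b) w := by
  induction w generalizing x H H' with
  | nil => simp only [sumSplits_cons, sumSplits_nil, H_nil, shift, add_zero, List.nil_append]
  | cons y w ih =>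
    rw [sumSplits_cons, sumSplits_cons (fun a b => H' (x :: a) b), shift, List.nil_append]
    exact congrArg _ (ih (H' := fun a => H' (x :: a)) (fun a => H_nil (x :: a))
      (fun a => shift (x :: a)) y)

theorem sumSplits_shift {H H' : List α → List α → M} (H_nil : ∀ a, H a [] = 0)
    (nil_H' : ∀ b, H' [] b = 0) (shift : ∀ a x b, H a (x :: b) = H' (a ++ [x]) b) (w : List α) :
    sumSplits H w = sumSplits H' w := by
  cases w with
  | nil => rw [sumSplits_nil, sumSplits_nil, H_nil, nil_H']
  | cons x w => rw [sumSplits_cons H', nil_H', zero_add, sumSplits_cons_shift H_nil shift]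

theorem sum_range_Icc_eq_sumSplits (H : List α → List α → List α → M) (w : List α) :
    ∑ k ∈ Finset.range (w.length + 1), ∑ l ∈ Finset.Icc k w.length,
        H (w.take k) ((w.take l).drop k) (w.drop l) =
      sumSplits (fun a u => sumSplits (H a) u) w := by
  refine Finset.sum_congr rfl fun k hk => ?_
  have length_drop : (w.drop k).length + 1 = w.length + 1 - k := by
    rw [List.length_drop, Nat.sub_add_comm (Finset.mem_range_succ_iff.1 hk)]
  rw [← Finset.Ico_succ_right_eq_Icc, Finset.sum_Ico_eq_sum_range, Nat.succ_eq_succ,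
    Nat.succ_eq_add_one, ← length_drop]
  refine Finset.sum_congr rfl fun m _ => ?_
  rw [List.drop_take, add_tsub_cancel_left, List.drop_drop]

theorem sum_range_Ioo_eq_sumSplits {H : List α → List α → List α → M}
    (mid_nil : ∀ a c, H a [] c = 0) (right_nil : ∀ a b, H a b [] = 0) (w : List α) :
    ∑ k ∈ Finset.range w.length, ∑ l ∈ Finset.Ioo k w.length,
        H (w.take k) ((w.take l).drop k) (w.drop l) =
      sumSplits (fun a u => sumSplits (H a) u) w := by
  rw [← sum_range_Icc_eq_sumSplits, Finset.sum_range_succ, Finset.Icc_self, Finset.sum_singleton,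
    List.drop_length, right_nil, add_zero]
  refine Finset.sum_congr rfl fun k _ => Finset.sum_subset Finset.Ioo_subset_Icc_self ?_
  intro l hl hl'
  obtain rfl | rfl : l = k ∨ l = w.length := by
    simp only [Finset.mem_Icc, Finset.mem_Ioo] at hl hl'; omega
  · rw [List.drop_take, Nat.sub_self, List.take_zero, mid_nil]
  · rw [List.drop_length, right_nil]

theorem sum_Icc_Ioc_eq_sumSplits {H : List α → List α → List α → M}
    (mid_nil : ∀ a c, H a [] c = 0) (left_nil : ∀ b c, H [] b c = 0) (w : List α) :
    ∑ k ∈ Finset.Icc 1 w.length, ∑ l ∈ Finset.Ioc k w.length,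
        H (w.take k) ((w.take l).drop k) (w.drop l) =
      sumSplits (fun a u => sumSplits (H a) u) w := by
  rw [← sum_range_Icc_eq_sumSplits]
  trans ∑ k ∈ Finset.Icc 1 w.length, ∑ l ∈ Finset.Icc k w.length,
    H (w.take k) ((w.take l).drop k) (w.drop l)
  · refine Finset.sum_congr rfl fun k _ => Finset.sum_subset Finset.Ioc_subset_Icc_self ?_
    intro l hl hl'
    obtain rfl : l = k := by simp only [Finset.mem_Icc, Finset.mem_Ioc] at hl hl'; omega
    rw [List.drop_take, Nat.sub_self, List.take_zero, mid_nil]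
  · refine Finset.sum_subset (fun k hk => ?_) fun k hk hk' => ?_
    · simp only [Finset.mem_Icc, Finset.mem_range] at hk ⊢; omega
    obtain rfl : k = 0 := by simp only [Finset.mem_Icc, Finset.mem_range] at hk hk'; omega
    simp only [List.take_zero, left_nil, Finset.sum_const_zero]

variable {R : Type*} [NonUnitalNonAssocSemiring R]

theorem mul_sumSplits (c : R) (H : List α → List α → R) (w : List α) :
    c * sumSplits H w = sumSplits (fun a b => c * H a b) w :=
  Finset.mul_sum _ _ _

theorem sumSplits_mul (H : List α → List α → R) (c : R) (w : List α) :
    sumSplits H w * c = sumSplits (fun a b => H a b * c) w :=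
  Finset.sum_mul _ _ _

end SumSplits

/-- Noncommutative formal power series over `R` in the letters `α`, given by their coefficients on
the words. -/
def NCPowerSeries (α R : Type*) : Type _ := List α → R

namespace NCPowerSeries

@[ext]
theorem ext {α R : Type*} {F G : NCPowerSeries α R} (h : ∀ w, F w = G w) : F = G := funext h

section Ring

variable {α R : Type*} [CommRing R]

instance : AddCommGroup (NCPowerSeries α R) := inferInstanceAs (AddCommGroup (List α → R))

instance {k : Type*} [Semiring k] [Module k R] : Module k (NCPowerSeries α R) :=
  inferInstanceAs (Module k (List α → R))

instance : One (NCPowerSeries α R) := ⟨fun w => if w = [] then 1 else 0⟩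

instance : Mul (NCPowerSeries α R) := ⟨fun F G w => sumSplits (fun a b => F a * G b) w⟩

theorem zero_apply (w : List α) : (0 : NCPowerSeries α R) w = 0 := rfl

theorem add_apply (F G : NCPowerSeries α R) (w : List α) : (F + G) w = F w + G w := rfl

theorem sub_apply (F G : NCPowerSeries α R) (w : List α) : (F - G) w = F w - G w := rfl

theorem smul_apply {k : Type*} [Semiring k] [Module k R] (c : k) (F : NCPowerSeries α R)
    (w : List α) : (c • F) w = c • F w := rfl

theorem one_apply_nil : (1 : NCPowerSeries α R) [] = 1 := rfl

theorem one_apply_cons (x : α) (w : List α) : (1 : NCPowerSeries α R) (x :: w) = 0 := rfl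

theorem mul_apply (F G : NCPowerSeries α R) (w : List α) :
    (F * G) w = sumSplits (fun a b => F a * G b) w := rfl

instance : Ring (NCPowerSeries α R) where
  __ := (inferInstance : AddCommGroup (NCPowerSeries α R))
  left_distrib F G H := by
    ext w
    simp only [mul_apply, add_apply, mul_add, sumSplits_add]
  right_distrib F G H := by
    ext w
    simp only [mul_apply, add_apply, add_mul, sumSplits_add]
  zero_mul F := by
    ext w
    simp only [mul_apply, zero_apply, zero_mul, sumSplits_zero]
  mul_zero F := by
    ext w
    simp only [mul_apply, zero_apply, mul_zero, sumSplits_zero]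
  mul_assoc F G H := by
    ext w
    simp only [mul_apply, sumSplits_mul, mul_sumSplits, mul_assoc]
    exact sumSplits_sumSplits _ w
  one_mul F := by
    ext w
    rw [mul_apply, sumSplits_eq_nil_left, one_apply_nil, one_mul]
    intro x a b
    rw [one_apply_cons, zero_mul]
  mul_one F := by
    ext w
    rw [mul_apply, sumSplits_eq_nil_right, one_apply_nil, mul_one]
    intro a x b
    rw [one_apply_cons, mul_zero]

instance {k : Type*} [CommRing k] [Algebra k R] : Algebra k (NCPowerSeries α R) :=
  Algebra.ofModule
    (fun c F G => by
      ext w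
      simp only [mul_apply, smul_apply, smul_mul_assoc, smul_sumSplits])
    (fun c F G => by
      ext w
      simp only [mul_apply, smul_apply, mul_smul_comm, smul_sumSplits])

theorem lie_apply (F G : NCPowerSeries α R) (w : List α) : ⁅F, G⁆ w = (F * G) w - (G * F) w := rfl

end Ring

section Letters

variable {α R : Type*} [CommRing R]

/-- The homogeneous series of degree one `∑ f(x) x`, summed over the letters `x`. -/
def letters (f : α → R) : NCPowerSeries α R
  | [x] => f x
  | _ => 0

theorem letters_apply_nil (f : α → R) : letters f [] = 0 := rfl

theorem letters_apply_singleton (f : α → R) (x : α) : letters f [x] = f x := rfl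

theorem letters_apply_cons_cons (f : α → R) (x y : α) (w : List α) :
    letters f (x :: y :: w) = 0 := rfl

theorem letters_neg (f : α → R) : letters (-f) = -letters f := by
  ext w
  rcases w with _ | ⟨x, _ | ⟨_, _⟩⟩
  exacts [neg_zero.symm, rfl, neg_zero.symm]

theorem letters_mul_apply_cons (f : α → R) (G : NCPowerSeries α R) (x : α) (w : List α) :
    (letters f * G) (x :: w) = f x * G w := by
  rw [mul_apply, sumSplits_cons, letters_apply_nil, zero_mul, zero_add, sumSplits_eq_nil_left,
    letters_apply_singleton]
  intro y a b
  rw [letters_apply_cons_cons, zero_mul]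

theorem mul_letters_apply_append_singleton (G : NCPowerSeries α R) (f : α → R) (w : List α)
    (x : α) : (G * letters f) (w ++ [x]) = G w * f x := by
  rw [mul_apply, sumSplits_append_singleton, letters_apply_nil, mul_zero, add_zero,
    sumSplits_eq_nil_right, List.nil_append, letters_apply_singleton]
  rintro a y (_ | ⟨_, _⟩) <;> exact mul_zero _

theorem lie_apply_nil (F G : NCPowerSeries α R) : ⁅F, G⁆ [] = 0 := by
  simp only [lie_apply, mul_apply, sumSplits_nil, mul_comm, sub_self]

end Letters

end NCPowerSeries

/-- An associative derivation, as a derivation of the Lie algebra of commutators. -/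
def lieDerivationOfLeibniz {k A : Type*} [CommRing k] [Ring A] [Algebra k A] (f : A → A)
    (map_add : ∀ x y, f (x + y) = f x + f y) (map_smul : ∀ (c : k) (x), f (c • x) = c • f x)
    (leibniz : ∀ x y, f (x * y) = f x * y + x * f y) : LieDerivation k A A where
  toFun := f
  map_add' := map_add
  map_smul' := map_smul
  leibniz' x y := by
    let g : A →+ A := AddMonoidHom.mk' f map_add
    change g (x * y - y * x) = (x * g y - g y * x) - (y * g x - g x * y)
    rw [map_sub]
    change f (x * y) - f (y * x) = (x * f y - f y * x) - (y * f x - f x * y)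
    rw [leibniz, leibniz]
    abel

namespace NCPowerSeries

section WeightDerivation

variable (k : Type*) {α R : Type*} [CommRing k] [CommRing R] [Algebra k R] (s : α → R)

/-- The derivation which multiplies the coefficient of `x₁ ⋯ x_r` by `s(x₁) + ⋯ + s(x_r)`. -/
def weightDerivation : LieDerivation k (NCPowerSeries α R) (NCPowerSeries α R) :=
  lieDerivationOfLeibniz (fun F w => (w.map s).sum * F w)
    (fun F G => by
      ext w
      exact mul_add _ _ _)
    (fun c F => by
      ext w
      exact mul_smul_comm _ _ _)
    fun F G => by
      ext w
      change (w.map s).sum * (F * G) w = sumSplits (fun a b => (a.map s).sum * F a * G b) w +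
        sumSplits (fun a b => F a * ((b.map s).sum * G b)) w
      rw [mul_apply, mul_sumSplits, ← sumSplits_add]
      refine sumSplits_congr ?_
      rintro a b rfl
      rw [List.map_append, List.sum_append]
      ring

variable {k s}

theorem weightDerivation_apply (F : NCPowerSeries α R) (w : List α) :
    weightDerivation k s F w = (w.map s).sum * F w := rfl

theorem weightDerivation_letters (f : α → R) :
    weightDerivation k s (letters f) = letters (s * f) := by
  ext w
  rw [weightDerivation_apply]
  rcases w with _ | ⟨x, _ | ⟨y, w⟩⟩
  · simp only [letters_apply_nil, mul_zero]
  · simp only [letters_apply_singleton, List.map_singleton, List.sum_singleton, Pi.mul_apply]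
  · simp only [letters_apply_cons_cons, mul_zero]

end WeightDerivation

section Contraction

variable {α : Type*} [Add α]

/-- The letter `x + v₁ + ⋯ + v_m`. -/
def letterSum (x : α) (v : List α) : α := v.foldl (· + ·) x

theorem letterSum_cons (x y : α) (v : List α) : letterSum x (y :: v) = letterSum (x + y) v := rfl

theorem letterSum_eq_sum {β : Type*} [AddMonoid β] (x : β) (v : List β) :
    letterSum x v = (x :: v).sum := by
  induction v generalizing x with
  | nil => exact List.sum_singleton.symm
  | cons y v ih => simp only [letterSum_cons, ih, List.sum_cons, add_assoc]

theorem map_letterSum {β F : Type*} [Add β] [FunLike F α β] [AddHomClass F α β] {s : F} (x : α)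
    (v : List α) : s (letterSum x v) = letterSum (s x) (v.map s) := by
  induction v generalizing x with
  | nil => rfl
  | cons y v ih => rw [letterSum_cons, ih, map_add, List.map_cons, letterSum_cons]

theorem sum_map_ne_zero {β F : Type*} [AddMonoid β] [FunLike F α β] [AddHomClass F α β] {s : F}
    (hs : ∀ x, s x ≠ 0) {w : List α} (hw : w ≠ []) : (w.map s).sum ≠ 0 := by
  obtain ⟨x, v, rfl⟩ := List.exists_cons_of_ne_nil hw
  rw [List.map_cons, ← letterSum_eq_sum, ← map_letterSum]
  exact hs _

variable {R : Type*} [CommRing R] (κ F G : NCPowerSeries α R)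

/-- The sum of `κ(x v) F(a ⟨x v⟩ c)` over the factorizations `u = (x v) c`, where `⟨x v⟩` is the
sum of the letters of `x v`. -/
def contractPrefix (a : List α) : List α → R
  | [] => 0
  | x :: u => sumSplits (fun v c => κ (x :: v) * F (a ++ letterSum x v :: c)) u

/-- The series whose coefficient on `w` is the sum of `κ(v) F(a ⟨v⟩ c)` over the factorizations
`w = a v c` with `v ≠ ∅`, where `⟨v⟩` is the sum of the letters of `v`. -/
def contract : NCPowerSeries α R := sumSplits (contractPrefix κ F)

variable {κ F G}

theorem contractPrefix_nil (a : List α) : contractPrefix κ F a [] = 0 := rfl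

theorem contractPrefix_cons (a : List α) (x : α) (u : List α) : contractPrefix κ F a (x :: u) =
    sumSplits (fun v c => κ (x :: v) * F (a ++ letterSum x v :: c)) u := rfl

theorem contractPrefix_mul (a u : List α) :
    contractPrefix κ (F * G) a u =
      sumSplits (fun t c => contractPrefix κ F a t * G c) u +
        sumSplits (fun a₁ a₂ => F a₁ * contractPrefix κ G a₂ u) a := by
  cases u with
  | nil =>
    simp only [contractPrefix_nil, mul_zero, zero_mul, sumSplits_zero, sumSplits_nil, add_zero]
  | cons x u =>
    simp only [sumSplits_cons, contractPrefix_nil, zero_mul, zero_add, contractPrefix_cons,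
      mul_apply, sumSplits_append_cons, mul_add, mul_sumSplits, sumSplits_mul, sumSplits_add,
      sumSplits_sumSplits]
    rw [add_comm, sumSplits_comm]
    simp only [mul_assoc, mul_left_comm (F _)]

theorem contract_apply (w : List α) : contract κ F w = sumSplits (contractPrefix κ F) w := rfl

theorem contract_add : contract κ (F + G) = contract κ F + contract κ G := by
  ext w
  simp only [add_apply, contract_apply, ← sumSplits_add]
  congr! with a u
  cases u with
  | nil => simp only [contractPrefix_nil, add_zero]
  | cons x u => simp only [contractPrefix_cons, add_apply, mul_add, sumSplits_add]

theorem contract_sub (κ' : NCPowerSeries α R) :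
    contract (κ - κ') F = contract κ F - contract κ' F := by
  ext w
  rw [sub_apply, eq_sub_iff_add_eq, contract_apply, contract_apply, contract_apply,
    ← sumSplits_add]
  congr! with a u
  cases u with
  | nil => simp only [contractPrefix_nil, add_zero]
  | cons x u =>
    simp only [contractPrefix_cons, ← sumSplits_add, sub_apply, ← add_mul,
      sub_add_cancel]

theorem contract_smul {k : Type*} [CommRing k] [Algebra k R] (c : k) :
    contract κ (c • F) = c • contract κ F := by
  ext w
  simp only [smul_apply, contract_apply, smul_sumSplits]
  congr! with a u
  cases u with
  | nil => simp only [contractPrefix_nil, smul_zero]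
  | cons x u => simp only [contractPrefix_cons, smul_apply, mul_smul_comm, smul_sumSplits]

theorem contract_mul : contract κ (F * G) = contract κ F * G + F * contract κ G := by
  ext w
  rw [contract_apply, sumSplits_congr fun a u _ => contractPrefix_mul a u]
  simp only [contract_apply, add_apply, mul_apply, sumSplits_add, sumSplits_mul, mul_sumSplits,
    sumSplits_sumSplits]

theorem contract_weightDerivation {k : Type*} [CommRing k] [Algebra k R] {S : Type*}
    [FunLike S α R] [AddHomClass S α R] (s : S) :
    contract κ (weightDerivation k s F) = weightDerivation k s (contract κ F) := by
  ext w
  simp only [contract_apply, weightDerivation_apply, mul_sumSplits]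
  refine sumSplits_congr ?_
  rintro a (_ | ⟨x, u⟩) rfl
  · simp only [contractPrefix_nil, mul_zero]
  · simp only [contractPrefix_cons, mul_sumSplits]
    refine sumSplits_congr ?_
    rintro v c rfl
    simp only [weightDerivation_apply, List.map_append, List.map_cons, List.sum_append,
      List.sum_cons, map_letterSum, letterSum_eq_sum]
    ring

theorem contract_letters (f : α → R) (x : α) (v : List α) :
    contract κ (letters f) (x :: v) = κ (x :: v) * f (letterSum x v) := by
  rw [contract_apply, sumSplits_eq_nil_left, contractPrefix_cons, sumSplits_eq_nil_right,
    List.nil_append, letters_apply_singleton]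
  · intro a y c
    rw [List.nil_append, letters_apply_cons_cons, mul_zero]
  · rintro y a (_ | ⟨z, u⟩)
    · exact contractPrefix_nil _
    · rw [contractPrefix_cons]
      refine (sumSplits_congr fun b c _ => ?_).trans (sumSplits_zero u)
      rw [List.cons_append]
      cases a <;> exact mul_zero _

theorem contract_letters_one (hκ : κ [] = 0) : contract κ (letters 1) = κ := by
  ext w
  cases w with
  | nil => rw [contract_apply, sumSplits_nil, contractPrefix_nil, hκ]
  | cons x v => rw [contract_letters, Pi.one_apply, mul_one]

end Contraction

section Arat

variable (k : Type*) {α R : Type*} [Add α] [CommRing k] [CommRing R] [Algebra k R]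

/-- The operator `arit(A)`, as a derivation of the series in an alphabet with an addition. The two
sums of its classical formula are the two terms of `⁅A, ∑ x⁆`. -/
def aritDerivation (A : NCPowerSeries α R) :
    LieDerivation k (NCPowerSeries α R) (NCPowerSeries α R) :=
  lieDerivationOfLeibniz (contract ⁅A, letters (1 : α → R)⁆) (fun _ _ => contract_add)
    (fun _ _ => contract_smul _) fun _ _ => contract_mul

/-- The derivation `arat(A) = ad(A) - arit(A)`. -/
def aratDerivation (A : NCPowerSeries α R) :
    LieDerivation k (NCPowerSeries α R) (NCPowerSeries α R) :=
  LieDerivation.ad k _ A - aritDerivation k A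

variable {k}

theorem aritDerivation_apply (A F : NCPowerSeries α R) :
    aritDerivation k A F = contract ⁅A, letters (1 : α → R)⁆ F := rfl

theorem aritDerivation_apply_nil (A F : NCPowerSeries α R) : aritDerivation k A F [] = 0 := by
  rw [aritDerivation_apply, contract_apply, sumSplits_nil, contractPrefix_nil]

theorem aratDerivation_apply (A F : NCPowerSeries α R) :
    aratDerivation k A F = ⁅A, F⁆ - aritDerivation k A F := by
  rw [aratDerivation, LieDerivation.sub_apply, LieDerivation.ad_apply_apply]

theorem aratDerivation_apply_nil (A F : NCPowerSeries α R) : aratDerivation k A F [] = 0 := by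
  rw [aratDerivation_apply, sub_apply, lie_apply_nil, aritDerivation_apply_nil, sub_self]

theorem aratDerivation_letters_one (A : NCPowerSeries α R) :
    aratDerivation k A (letters 1) = 0 := by
  rw [aratDerivation_apply, aritDerivation_apply, contract_letters_one (lie_apply_nil _ _),
    sub_self]

variable {S : Type*} [FunLike S α R] [AddHomClass S α R] (s : S)

theorem aratDerivation_weightDerivation (A F : NCPowerSeries α R) :
    aratDerivation k A (weightDerivation k s F) =
      weightDerivation k s (aratDerivation k A F) - ⁅weightDerivation k s A, F⁆ := by
  simp only [aratDerivation_apply, aritDerivation_apply, contract_weightDerivation, map_sub,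
    LieDerivation.apply_lie_eq_add]
  abel

theorem aratDerivation_weightDerivation_sub (A B : NCPowerSeries α R) :
    aratDerivation k A (weightDerivation k s B) - aratDerivation k B (weightDerivation k s A) =
      weightDerivation k s (aritDerivation k B A - aritDerivation k A B + ⁅A, B⁆) := by
  have lie_swap : ⁅weightDerivation k s B, A⁆ = -⁅A, weightDerivation k s B⁆ := (lie_skew _ _).symm
  have lie_swap' : ⁅B, A⁆ = -⁅A, B⁆ := (lie_skew _ _).symm
  rw [aratDerivation_weightDerivation, aratDerivation_weightDerivation, lie_swap]
  simp only [aratDerivation_apply, lie_swap', map_sub, map_add, map_neg,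
    LieDerivation.apply_lie_eq_add]
  abel

end Arat

section Pullback

variable {k α β R S : Type*} [CommRing k] [CommRing R] [CommRing S] [Algebra k R] [Algebra k S]

/-- The change of letters and of coefficients which sends the letter `y` to the sum of the letters
`c(x) x` over `g(x) = y`. -/
def pullback (g : α → β) (φ : R →ₐ[k] S) (c : α → S) :
    NCPowerSeries β R →ₐ[k] NCPowerSeries α S :=
  AlgHom.ofLinearMap
    { toFun := fun F w => (w.map c).prod * φ (F (w.map g))
      map_add' := fun F G => by
        ext w
        change _ * φ (F (w.map g) + G (w.map g)) = _ * φ (F (w.map g)) + _ * φ (G (w.map g))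
        rw [map_add, mul_add]
      map_smul' := fun t F => by
        ext w
        change _ * φ (t • F (w.map g)) = t • (_ * φ (F (w.map g)))
        rw [map_smul, mul_smul_comm] }
    (by
      ext w
      cases w with
      | nil => exact (one_mul _).trans (map_one φ)
      | cons x w => exact (congrArg _ (map_zero φ)).trans (mul_zero _))
    (fun F G => by
      ext w
      change (w.map c).prod * φ ((F * G) (w.map g)) =
        sumSplits (fun a b => ((a.map c).prod * φ (F (a.map g))) *
          ((b.map c).prod * φ (G (b.map g)))) w
      rw [mul_apply, sumSplits_map, map_sumSplits, mul_sumSplits]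
      refine sumSplits_congr ?_
      rintro a b rfl
      rw [List.map_append, List.prod_append, map_mul]
      ring)

theorem pullback_apply (g : α → β) (φ : R →ₐ[k] S) (c : α → S) (F : NCPowerSeries β R)
    (w : List α) : pullback g φ c F w = (w.map c).prod * φ (F (w.map g)) := rfl

theorem pullback_letters (g : α → β) (φ : R →ₐ[k] S) (c : α → S) (f : β → R) :
    pullback g φ c (letters f) = letters fun x => c x * φ (f (g x)) := by
  ext w
  rw [pullback_apply]
  rcases w with _ | ⟨x, _ | ⟨y, w⟩⟩
  · simp [letters_apply_nil]
  · simp [letters_apply_singleton]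
  · simp [letters_apply_cons_cons]

theorem pullback_id_one_apply (g : α → β) (F : NCPowerSeries β R)
    (w : List α) : pullback g (AlgHom.id k R) 1 F w = F (w.map g) := by
  rw [pullback_apply, List.prod_eq_one (by simp), one_mul, AlgHom.id_apply]

variable [Add α] [Add β] {T : Type*} [FunLike T α β] [AddHomClass T α β] (s : T)

theorem pullback_contract (κ F : NCPowerSeries β R) :
    pullback s (AlgHom.id k R) 1 (contract κ F) =
      contract (pullback s (AlgHom.id k R) 1 κ) (pullback s (AlgHom.id k R) 1 F) := by
  ext w
  rw [pullback_id_one_apply, contract_apply, contract_apply, sumSplits_map]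
  refine sumSplits_congr ?_
  rintro a (_ | ⟨x, u⟩) rfl
  · rfl
  · rw [List.map_cons, contractPrefix_cons, contractPrefix_cons, sumSplits_map]
    simp only [pullback_id_one_apply, List.map_append, List.map_cons, map_letterSum]

theorem pullback_aritDerivation (B F : NCPowerSeries β R) :
    pullback s (AlgHom.id k R) 1 (aritDerivation k B F) =
      aritDerivation k (pullback s (AlgHom.id k R) 1 B) (pullback s (AlgHom.id k R) 1 F) := by
  rw [aritDerivation_apply, aritDerivation_apply, pullback_contract,
    LieRing.of_associative_ring_bracket, LieRing.of_associative_ring_bracket, map_sub, map_mul,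
    map_mul, pullback_letters]
  simp only [Pi.one_apply, map_one, mul_one]
  rfl

end Pullback

section Evaluation

variable {α β R S : Type*} [CommRing R] [CommRing S] [Algebra ℚ R] [Algebra ℚ S]

/-- The evaluation of the noncommutative polynomials in the `C_i` at homogeneous series of degree
one, `C_{n+1} ↦ ∑ f(n, x) x`. -/
def evalC (f : ℕ → α → R) : PolyC →ₐ[ℚ] NCPowerSeries α R :=
  MonoidAlgebra.lift ℚ _ _ (FreeMonoid.lift fun n => letters (f n))

theorem evalC_of (f : ℕ → α → R) (n : ℕ) :
    evalC f (MonoidAlgebra.of ℚ _ (FreeMonoid.of n)) = letters (f n) := by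
  rw [evalC, MonoidAlgebra.lift_of, FreeMonoid.lift_eval_of]

theorem pullback_evalC (g : α → β) (φ : R →ₐ[ℚ] S) (c : α → S) (f : ℕ → β → R) (p : PolyC) :
    pullback g φ c (evalC f p) = evalC (fun n x => c x * φ (f n (g x))) p := by
  suffices (pullback g φ c).comp (evalC f) = evalC fun n x => c x * φ (f n (g x)) from
    AlgHom.congr_fun this p
  refine MonoidAlgebra.algHom_ext' (FreeMonoid.hom_eq fun n => ?_) (Subsingleton.elim _ _)
  change pullback g φ c (evalC f (.of ℚ _ (.of n))) = evalC _ (.of ℚ _ (.of n))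
  rw [evalC_of, evalC_of, pullback_letters]

end Evaluation

section SeriesLieHom

variable {α K : Type*} [Field K] [Algebra ℚ K] (s : α → K)

/-- The morphism `C_{n+1} ↦ ∑ (-s(x))ⁿ/s(x) x`. On a word `x₁ ⋯ x_r` its value at `Q` is that of
`ma(Q) / (u₁ ⋯ u_r)` at `u_i = s(x_i)`. -/
def seriesLieHom : LieC →ₗ⁅ℚ⁆ NCPowerSeries α K :=
  (evalC fun n x => (-s x) ^ n / s x).toLieHom.comp expandLieHom

theorem seriesLieHom_of (n : ℕ) :
    seriesLieHom s (.of ℚ n) = letters fun x => (-s x) ^ n / s x := by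
  rw [← evalC_of fun n x => (-s x) ^ n / s x]
  exact congrArg (evalC _) (FreeLieAlgebra.lift_of_apply _ n)

theorem seriesLieHom_apply_nil (Q : LieC) : seriesLieHom s Q [] = 0 := by
  have mem_lieSpan : Q ∈ LieSubalgebra.lieSpan ℚ LieC (Set.range (FreeLieAlgebra.of ℚ)) :=
    lieSpan_range_freeLieAlgebra_of (R := ℚ) ▸ LieSubalgebra.mem_top Q
  induction mem_lieSpan using LieSubalgebra.lieSpan_induction with
  | mem Q hQ =>
    obtain ⟨n, rfl⟩ := hQ
    rw [seriesLieHom_of, letters_apply_nil]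
  | zero => rw [map_zero, zero_apply]
  | add P Q _ _ hP hQ => rw [map_add, add_apply, hP, hQ, add_zero]
  | smul c Q _ hQ => rw [map_smul, smul_apply, hQ, Algebra.smul_def, mul_zero]
  | lie P Q => rw [LieHom.map_lie, lie_apply_nil]

theorem seriesLieHom_shiftC (Q : LieC) :
    seriesLieHom s (shiftC Q) = -weightDerivation ℚ s (seriesLieHom s Q) := by
  refine map_lieDerivation_freeLieAlgebra (D' := -weightDerivation ℚ s) (fun n => ?_) Q
  rw [shiftC_of, LieDerivation.neg_apply, seriesLieHom_of, seriesLieHom_of,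
    weightDerivation_letters, ← letters_neg]
  congr 1
  ext x
  simp only [Pi.neg_apply, Pi.mul_apply]
  ring

theorem seriesLieHom_of_one (hs : ∀ x, s x ≠ 0) : seriesLieHom s (.of ℚ 1) = -letters 1 := by
  rw [seriesLieHom_of, ← letters_neg]
  congr 1
  ext x
  rw [pow_one, neg_div, div_self (hs x)]
  rfl

end SeriesLieHom

section InducedDerivation

variable {α K S : Type*} [Add α] [Field K] [Algebra ℚ K] [FunLike S α K] [AddHomClass S α K]
  {s : S} (hs : ∀ x, s x ≠ 0)
include hs

theorem eq_zero_of_weightDerivation_eq_zero {F : NCPowerSeries α K}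
    (hF : weightDerivation ℚ s F = 0) (hnil : F [] = 0) : F = 0 := by
  ext w
  rcases eq_or_ne w [] with rfl | hw
  · exact hnil
  · exact (mul_eq_zero.1 (congrFun hF w)).resolve_left (sum_map_ne_zero hs hw)

-- Both sides commute in the same way with the shift `C_n ↦ C_{n+1}`, which becomes the injective
-- operator `-∂` on series, so their agreement on `C₂ = [a, b]` spreads to all the `C_n`.
theorem seriesLieHom_inducedDerivation {D : DerAB} (hD : D ∈ derLieC) {A : NCPowerSeries α K}
    (hA : weightDerivation ℚ s A = seriesLieHom s (partC (D genA))) (Q : LieC) :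
    seriesLieHom s (inducedDerivation D Q) = aratDerivation ℚ A (seriesLieHom s Q) := by
  set defect : LieC → NCPowerSeries α K := fun Q =>
    seriesLieHom s (inducedDerivation D Q) - aratDerivation ℚ A (seriesLieHom s Q) with defect_def
  have defect_shiftC (Q : LieC) : defect (shiftC Q) = -weightDerivation ℚ s (defect Q) := by
    simp only [defect_def, inducedDerivation_shiftC hD, map_add, LieHom.map_lie,
      seriesLieHom_shiftC, ← hA, map_neg, aratDerivation_weightDerivation, map_sub]
    abel
  have defect_nil (Q : LieC) : defect Q [] = 0 := by
    simp only [defect_def, sub_apply, seriesLieHom_apply_nil, aratDerivation_apply_nil, sub_self]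
  have defect_of_one : defect (.of ℚ 1) = 0 := by
    simp only [defect_def, inducedDerivation_of_one hD, seriesLieHom_of_one s hs, map_zero, map_neg,
      aratDerivation_letters_one, neg_zero, sub_zero]
  have defect_of (n : ℕ) : defect (.of ℚ n) = 0 := by
    induction n with
    | zero =>
      refine eq_zero_of_weightDerivation_eq_zero hs ?_ (defect_nil _)
      rw [← neg_eq_zero, ← defect_shiftC, shiftC_of, defect_of_one]
    | succ n ih => rw [← shiftC_of, defect_shiftC, ih, map_zero, neg_zero]
  exact map_lieDerivation_freeLieAlgebra (fun n => sub_eq_zero.1 (defect_of n)) Q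

theorem seriesLieHom_partC_lie_apply {D E : DerAB} (hD : D ∈ derLieC) (hE : E ∈ derLieC)
    {A B : NCPowerSeries α K} (hA : weightDerivation ℚ s A = seriesLieHom s (partC (D genA)))
    (hB : weightDerivation ℚ s B = seriesLieHom s (partC (E genA))) :
    seriesLieHom s (partC (⁅D, E⁆ genA)) =
      weightDerivation ℚ s (aritDerivation ℚ B A - aritDerivation ℚ A B + ⁅A, B⁆) := by
  rw [LieDerivation.commutator_apply, map_sub, map_sub, partC_apply_apply hD hE,
    partC_apply_apply hE hD, seriesLieHom_inducedDerivation hs hD hA,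
    seriesLieHom_inducedDerivation hs hE hB, ← hA, ← hB, aratDerivation_weightDerivation_sub]

end InducedDerivation

end NCPowerSeries

open NCPowerSeries

/-- The word `(u₁, …, u_r)` of polynomials. -/
def polyWord (r : ℕ) : List (MvPolynomial (Fin r) ℚ) := List.ofFn MvPolynomial.X

section EvalRat

variable {s : ℕ} {K : Type} [Field K] [Algebra ℚ K] (x : Fin s → K)

theorem evalRat_div (p : MvPolynomial (Fin s) ℚ) {q : MvPolynomial (Fin s) ℚ}
    (hq : MvPolynomial.aeval x q ≠ 0) :
    evalRat x (algebraMap _ (RatFun s) p / algebraMap _ (RatFun s) q) =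
      MvPolynomial.aeval x p / MvPolynomial.aeval x q := by
  set F : RatFun s := algebraMap _ (RatFun s) p / algebraMap _ (RatFun s) q with F_def
  set num := IsFractionRing.num (MvPolynomial (Fin s) ℚ) F
  set den := (IsFractionRing.den (MvPolynomial (Fin s) ℚ) F : MvPolynomial (Fin s) ℚ)
  have algebraMap_injective := IsFractionRing.injective (MvPolynomial (Fin s) ℚ) (RatFun s)
  have cross_mul : num * q = p * den := by
    apply algebraMap_injective
    rw [map_mul, map_mul, ← div_eq_div_iff, IsFractionRing.mk'_num_den']
    · exact (map_ne_zero_iff _ algebraMap_injective).2 (nonZeroDivisors.coe_ne_zero _)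
    · exact (map_ne_zero_iff _ algebraMap_injective).2 (by rintro rfl; exact hq (map_zero _))
  obtain ⟨t, q_eq⟩ : den ∣ q :=
    (IsFractionRing.num_den_reduced (MvPolynomial (Fin s) ℚ) F).symm.dvd_of_dvd_mul_left
      ⟨p, by rw [cross_mul, mul_comm]⟩
  have aeval_den_ne_zero : MvPolynomial.aeval x den ≠ 0 := fun h =>
    hq (by rw [q_eq, map_mul, h, zero_mul])
  rw [evalRat, div_eq_div_iff aeval_den_ne_zero hq, ← map_mul, cross_mul, map_mul]

theorem map_aeval_polyWord : (polyWord s).map (MvPolynomial.aeval x) = List.ofFn x := by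
  rw [polyWord, List.map_ofFn]
  exact congrArg _ (funext fun i => MvPolynomial.aeval_X x i)

theorem evalRat_zero : evalRat x (0 : RatFun s) = 0 := by
  have h := evalRat_div x 0 (q := 1) (by rw [map_one]; exact one_ne_zero)
  rwa [map_zero, map_zero, zero_div, zero_div] at h

theorem aeval_var {r : ℕ} (p : MvPolynomial (Fin r) ℚ) :
    MvPolynomial.aeval (var (r := r)) p = algebraMap _ (RatFun r) p := by
  induction p using MvPolynomial.induction_on with
  | C c =>
    rw [MvPolynomial.aeval_C]
    exact RingHom.congr_fun (Subsingleton.elim _ ((algebraMap _ (RatFun r)).comp MvPolynomial.C)) c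
  | add p q hp hq => rw [map_add, map_add, hp, hq]
  | mul_X p i hp => rw [map_mul, map_mul, hp, MvPolynomial.aeval_X, var]

theorem evalRat_var {r : ℕ} (F : RatFun r) : evalRat var F = F := by
  rw [evalRat, aeval_var, aeval_var, IsFractionRing.mk'_num_den']

theorem atWord_ofFn (A : Mould) : atWord A (List.ofFn x) = evalRat x (A s) := by
  have key (l : List K) (hl : l.length = s) (hx : ∀ i, l.get i = x (Fin.cast hl i)) :
      atWord A l = evalRat x (A s) := by
    subst hl
    exact congrArg (evalRat · _) (funext hx)
  exact key _ List.length_ofFn fun i => List.get_ofFn x i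

theorem atWord_genericWord (A : Mould) (r : ℕ) : atWord A (genericWord r) = A r := by
  rw [genericWord, atWord_ofFn, evalRat_var]

theorem atWord_nil (A : ARI) : atWord (A : Mould) ([] : List K) = 0 :=
  (congrArg (evalRat _) A.2).trans (evalRat_zero _)

end EvalRat

section MaSeries

variable {R S : Type*} [CommRing R] [CommRing S] [Algebra ℚ R] [Algebra ℚ S]

/-- The map `ma`, with value at `p` the series in the alphabet `R` whose coefficient on the word
`u₁ ⋯ u_r` is `ma(p)(u₁, …, u_r)`. -/
def maSeries (R : Type*) [CommRing R] [Algebra ℚ R] : PolyC →ₐ[ℚ] NCPowerSeries R R :=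
  evalC fun n x => (-x) ^ n

theorem map_maSeries (φ : R →ₐ[ℚ] S) (p : PolyC) (w : List R) :
    φ (maSeries R p w) = maSeries S p (w.map φ) := by
  have coeff_map : pullback id φ 1 (maSeries R p) w = φ (maSeries R p w) := by
    rw [pullback_apply, List.map_id, List.prod_eq_one (by simp), one_mul]
  have letter_map := pullback_id_one_apply (k := ℚ) φ (maSeries S p) w
  rw [← coeff_map, ← letter_map, maSeries, maSeries, pullback_evalC, pullback_evalC]
  simp only [id_eq, map_pow, map_neg, AlgHom.id_apply]

theorem maSeries_single_nil : maSeries R (.single (FreeMonoid.ofList []) 1) = 1 :=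
  map_one (maSeries R)

theorem maSeries_single_cons (n : ℕ) (v : List ℕ) :
    maSeries R (.single (FreeMonoid.ofList (n :: v)) 1) =
      letters (fun x => (-x) ^ n) * maSeries R (.single (FreeMonoid.ofList v) 1) := by
  rw [← evalC_of fun n (x : R) => (-x) ^ n]
  change _ = maSeries R _ * _
  rw [← map_mul, MonoidAlgebra.of_apply, MonoidAlgebra.single_mul_single, one_mul,
    FreeMonoid.ofList_cons]

theorem maSeries_single_apply_of_length_ne {v : List ℕ} {w : List R} (h : v.length ≠ w.length) :
    maSeries R (.single (FreeMonoid.ofList v) 1) w = 0 := by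
  induction v generalizing w with
  | nil =>
    obtain ⟨x, w, rfl⟩ := List.exists_cons_of_length_pos (Nat.pos_of_ne_zero h.symm)
    rw [maSeries_single_nil, one_apply_cons]
  | cons n v ih =>
    rw [maSeries_single_cons]
    cases w with
    | nil => rw [mul_apply, sumSplits_nil, letters_apply_nil, zero_mul]
    | cons x w =>
      rw [letters_mul_apply_cons, ih (fun hvw => h (congrArg (· + 1) hvw)), mul_zero]

theorem maSeries_single_apply_ofFn {r : ℕ} (y : Fin r → ℕ) (x : Fin r → R) :
    maSeries R (.single (FreeMonoid.ofList (List.ofFn y)) 1) (List.ofFn x) =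
      ∏ j, (-x j) ^ y j := by
  induction r with
  | zero => exact congrFun maSeries_single_nil []
  | succ r ih =>
    rw [List.ofFn_succ, List.ofFn_succ, maSeries_single_cons, letters_mul_apply_cons, ih,
      Fin.prod_univ_succ]

theorem maWord_apply (v : List ℕ) (r : ℕ) :
    maWord v r = maSeries (RatFun r) (.single (FreeMonoid.ofList v) 1) (genericWord r) := by
  rcases eq_or_ne v.length r with rfl | h
  · have maSeries_apply := maSeries_single_apply_ofFn v.get (var (r := v.length))
    rw [List.ofFn_get] at maSeries_apply
    rw [maWord, Pi.single_eq_same, genericWord, maSeries_apply, ← Fin.sum_univ_getElem,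
      ← Finset.prod_pow_eq_pow_sum, ← Finset.prod_mul_distrib]
    exact Finset.prod_congr rfl fun j _ => (neg_pow _ _).symm
  · rw [maWord, Pi.single_eq_of_ne h.symm, maSeries_single_apply_of_length_ne]
    rwa [genericWord, List.length_ofFn]

theorem maPoly_single (v : List ℕ) : maPoly (.single (FreeMonoid.ofList v) 1) = maWord v :=
  (Finsupp.linearCombination_single ℚ 1 _).trans (one_smul ℚ _)

theorem maPoly_apply (p : PolyC) (r : ℕ) :
    maPoly p r = maSeries (RatFun r) p (genericWord r) := by
  induction p using MonoidAlgebra.induction_on with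
  | of m =>
    obtain ⟨v, rfl⟩ := FreeMonoid.ofList.surjective m
    rw [MonoidAlgebra.of_apply, maPoly_single, maWord_apply]
  | add p q hp hq => rw [map_add, map_add, Pi.add_apply, hp, hq, NCPowerSeries.add_apply]
  | smul c p hp => rw [map_smul, map_smul, Pi.smul_apply, hp, NCPowerSeries.smul_apply]

theorem coeff_prod_neg_X_pow {r : ℕ} (y z : Fin r → ℕ) :
    MvPolynomial.coeff (Finsupp.equivFunOnFinite.symm z)
        (∏ j, (-MvPolynomial.X j : MvPolynomial (Fin r) ℚ) ^ y j) =
      if y = z then (-1) ^ ∑ j, z j else 0 := by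
  have prod_eq_monomial : ∏ j, (-MvPolynomial.X j : MvPolynomial (Fin r) ℚ) ^ y j =
      MvPolynomial.monomial (Finsupp.equivFunOnFinite.symm y) ((-1) ^ ∑ j, y j) := by
    rw [MvPolynomial.monomial_eq, Finsupp.prod_fintype _ _ fun _ => pow_zero _, map_pow, map_neg,
      map_one, ← Finset.prod_pow_eq_pow_sum, ← Finset.prod_mul_distrib]
    exact Finset.prod_congr rfl fun j _ => neg_pow _ _
  rw [prod_eq_monomial, MvPolynomial.coeff_monomial]
  simp only [EmbeddingLike.apply_eq_iff_eq]
  split_ifs with h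
  · rw [h]
  · rfl

theorem coeff_maSeries (p : PolyC) {r : ℕ} (z : Fin r → ℕ) :
    MvPolynomial.coeff (Finsupp.equivFunOnFinite.symm z)
        (maSeries (MvPolynomial (Fin r) ℚ) p (polyWord r)) =
      (-1) ^ (∑ j, z j) * p.coeff (FreeMonoid.ofList (List.ofFn z)) := by
  classical
  induction p using MonoidAlgebra.induction_on with
  | of m =>
    obtain ⟨v, rfl⟩ := FreeMonoid.ofList.surjective m
    rw [MonoidAlgebra.of_apply, MonoidAlgebra.coeff_single, Finsupp.single_apply]
    by_cases hv : v.length = r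
    · obtain ⟨y, rfl⟩ : ∃ y : Fin r → ℕ, List.ofFn y = v := by
        subst hv
        exact ⟨v.get, List.ofFn_get v⟩
      rw [polyWord, maSeries_single_apply_ofFn, coeff_prod_neg_X_pow]
      simp only [EmbeddingLike.apply_eq_iff_eq, List.ofFn_inj, mul_ite, mul_one, mul_zero]
    · rw [maSeries_single_apply_of_length_ne (by rwa [polyWord, List.length_ofFn]),
        MvPolynomial.coeff_zero, if_neg, mul_zero]
      rintro h
      rw [FreeMonoid.ofList.injective h, List.length_ofFn] at hv
      exact hv rfl
  | add p q hp hq =>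
    rw [map_add, NCPowerSeries.add_apply, MvPolynomial.coeff_add, hp, hq, ← mul_add]
    rfl
  | smul c p hp =>
    rw [map_smul, NCPowerSeries.smul_apply, MvPolynomial.coeff_smul, hp, smul_eq_mul, mul_left_comm]
    rfl

theorem maPoly_injective : Function.Injective maPoly := by
  rw [injective_iff_map_eq_zero]
  intro p maPoly_eq_zero
  have polyWord_eq_zero (r : ℕ) :
      maSeries (MvPolynomial (Fin r) ℚ) p (polyWord r) = 0 := by
    apply IsFractionRing.injective (MvPolynomial (Fin r) ℚ) (RatFun r)
    rw [map_zero, ← aeval_var, map_maSeries, map_aeval_polyWord]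
    exact (maPoly_apply p r).symm.trans (congrFun maPoly_eq_zero r)
  apply MonoidAlgebra.coeff_injective
  refine Finsupp.ext fun m => ?_
  have coeff_eq := coeff_maSeries p m.toList.get
  rw [polyWord_eq_zero, MvPolynomial.coeff_zero, List.ofFn_get] at coeff_eq
  exact (mul_eq_zero.1 coeff_eq.symm).resolve_left (pow_ne_zero _ (by norm_num))

end MaSeries

section MouldSeries

variable {K : Type} [Field K] [Algebra ℚ K]

theorem atWord_Da (P : LieAB) {w : List K} (prod_ne_zero : w.prod ≠ 0) (sum_ne_zero : w.sum ≠ 0) :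
    atWord (Da P : Mould) w = maSeries K (expandC (partC P)) w / (w.prod * w.sum) := by
  set p := expandC (partC P)
  obtain ⟨r, x, rfl⟩ : ∃ (r : ℕ) (x : Fin r → K), List.ofFn x = w :=
    ⟨w.length, w.get, List.ofFn_get w⟩
  have aeval_den {L : Type} [Field L] [Algebra ℚ L] (y : Fin r → L) :
      MvPolynomial.aeval y ((polyWord r).prod * (polyWord r).sum) =
        (List.ofFn y).prod * (List.ofFn y).sum := by
    rw [map_mul, map_list_prod, map_list_sum, map_aeval_polyWord]
  have r_ne_zero : r ≠ 0 := by
    rintro rfl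
    exact sum_ne_zero rfl
  have Da_eq : (Da P : Mould) r = algebraMap _ (RatFun r) (maSeries _ p (polyWord r)) /
      algebraMap _ (RatFun r) ((polyWord r).prod * (polyWord r).sum) := by
    rw [← aeval_var, ← aeval_var, aeval_den, map_maSeries, map_aeval_polyWord, List.prod_ofFn,
      List.sum_ofFn]
    exact (if_neg r_ne_zero).trans (congrArg (· / _) (maPoly_apply p r))
  rw [atWord_ofFn, Da_eq, evalRat_div, aeval_den, map_maSeries, map_aeval_polyWord]
  rw [aeval_den]
  exact mul_ne_zero prod_ne_zero sum_ne_zero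

/-- The series whose coefficient on the word `x₁ ⋯ x_r` is `A(s(x₁), …, s(x_r))`. -/
def mouldSeries {α : Type*} (s : α → K) (A : Mould) : NCPowerSeries α K :=
  fun w => atWord A (w.map s)

theorem mouldSeries_apply {α : Type*} (s : α → K) (A : Mould) (w : List α) :
    mouldSeries s A w = atWord A (w.map s) := rfl

theorem seriesLieHom_apply {α : Type*} (s : α → K) (Q : LieC) (w : List α) :
    seriesLieHom s Q w = (w.map s).prod⁻¹ * maSeries K (expandC Q) (w.map s) := by
  have h : pullback s (AlgHom.id ℚ K) (fun x => (s x)⁻¹) (maSeries K (expandC Q)) =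
      seriesLieHom s Q := by
    rw [maSeries, pullback_evalC]
    simp only [AlgHom.id_apply, ← div_eq_inv_mul]
    rfl
  rw [← h, pullback_apply, AlgHom.id_apply, List.prod_inv, List.map_map]
  rfl

variable {α S : Type*} [Add α] [FunLike S α K] [AddHomClass S α K] {s : S}

theorem weightDerivation_mouldSeries_Da (hs : ∀ x, s x ≠ 0) (P : LieAB) :
    weightDerivation ℚ s (mouldSeries s (Da P)) = seriesLieHom s (partC P) := by
  ext w
  rcases eq_or_ne w [] with rfl | hw
  · rw [seriesLieHom_apply_nil, weightDerivation_apply, mouldSeries_apply, List.map_nil, atWord_nil,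
      mul_zero]
  · have sum_ne_zero := sum_map_ne_zero hs hw
    have prod_ne_zero : (w.map s).prod ≠ 0 := List.prod_ne_zero (by simpa using fun x _ => hs x)
    rw [weightDerivation_apply, mouldSeries_apply, seriesLieHom_apply,
      atWord_Da P prod_ne_zero sum_ne_zero]
    field_simp

end MouldSeries

section GenericAlphabet

/-- The letters `u₁, …, u_r` and their formal sums. This alphabet replaces `RatFun r`, where a
subword may have sum zero. -/
abbrev GenericLetter (r : ℕ) : Type := FreeAddSemigroup (Fin r)

/-- The value of a formal sum of the letters `u₁, …, u_r`. -/
def genericSum (r : ℕ) : GenericLetter r →ₙ+ RatFun r := FreeAddSemigroup.lift var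

theorem genericSum_ne_zero {r : ℕ} (x : GenericLetter r) : genericSum r x ≠ 0 := by
  obtain ⟨p, hp, p_pos⟩ : ∃ p : MvPolynomial (Fin r) ℚ,
      genericSum r x = algebraMap _ (RatFun r) p ∧ 0 < MvPolynomial.eval (fun _ => 1) p := by
    induction x using FreeAddSemigroup.recOnAdd with
    | ih1 i =>
      exact ⟨.X i, FreeAddSemigroup.lift_of _ i, by rw [MvPolynomial.eval_X]; exact one_pos⟩
    | ih2 i x hi hx =>
      obtain ⟨p, hp, p_pos⟩ := hi
      obtain ⟨q, hq, q_pos⟩ := hx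
      exact ⟨p + q, by rw [map_add, map_add, hp, hq], by rw [map_add]; exact add_pos p_pos q_pos⟩
  rw [hp, map_ne_zero_iff _ (IsFractionRing.injective _ _)]
  rintro rfl
  exact p_pos.ne' (map_zero _)

/-- The word `u₁ ⋯ u_r`. -/
def genericLetters (r : ℕ) : List (GenericLetter r) := List.ofFn FreeAddSemigroup.of

theorem map_genericLetters (r : ℕ) : (genericLetters r).map (genericSum r) = genericWord r := by
  rw [genericLetters, List.map_ofFn, genericWord]
  exact congrArg _ (funext fun i => FreeAddSemigroup.lift_of _ i)

theorem mouldSeries_genericLetters (A : Mould) (r : ℕ) :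
    mouldSeries (genericSum r) A (genericLetters r) = A r := by
  rw [mouldSeries_apply, map_genericLetters, atWord_genericWord]

end GenericAlphabet

section Flexions

variable {K : Type} [Field K] (F B : NCPowerSeries K K)

theorem contract_mul_letters_one (w : List K) :
    contract (B * letters 1) F w = sumSplits (fun a u => sumSplits
      (fun b c => if c = [] then 0 else F (flexLeft a b c) * B b) u) w := by
  rw [contract_apply]
  refine sumSplits_congr fun a u _ => ?_
  have mul_letters_nil : (B * letters (1 : K → K)) [] = 0 := by
    rw [mul_apply, sumSplits_nil, letters_apply_nil, mul_zero]
  rw [sumSplits_shift (H' := fun b c => (B * letters (1 : K → K)) b * F (a ++ b.sum :: c))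
    (fun b => if_pos rfl) (fun c => by rw [mul_letters_nil, zero_mul]) (fun b x c => ?_)]
  · cases u with
    | nil => rw [sumSplits_nil, mul_letters_nil, zero_mul, contractPrefix_nil]
    | cons x u =>
      rw [sumSplits_cons, mul_letters_nil, zero_mul, zero_add, contractPrefix_cons]
      simp only [letterSum_eq_sum]
  · rw [if_neg (List.cons_ne_nil x c), mul_letters_apply_append_singleton, Pi.one_apply, mul_one,
      List.sum_append, List.sum_singleton, flexLeft, mul_comm]

theorem contract_letters_one_mul (w : List K) :
    contract (letters 1 * B) F w = sumSplits (fun a u => sumSplits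
      (fun b c => if a = [] then 0 else F (flexRight a b c) * B b) u) w := by
  rw [contract_apply]
  refine sumSplits_shift contractPrefix_nil (fun u => ?_) (fun a x u => ?_) w
  · simp only [if_true]
    exact sumSplits_zero u
  · rw [contractPrefix_cons]
    refine sumSplits_congr fun b c _ => ?_
    rw [if_neg (by simp), letters_mul_apply_cons, letterSum_eq_sum, flexRight]
    simp [mul_comm]

end Flexions

section Ari

theorem mouldSeries_id_apply {K : Type} [Field K] [Algebra ℚ K] (A : Mould) (w : List K) :
    mouldSeries id A w = atWord A w := by
  rw [mouldSeries_apply, List.map_id]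

theorem mu_apply (A B : Mould) (r : ℕ) :
    mu A B r = (mouldSeries id A * mouldSeries id B : NCPowerSeries (RatFun r) (RatFun r))
      (genericWord r) := by
  rw [mul_apply, sumSplits, genericWord, List.length_ofFn]
  simp only [mouldSeries_id_apply]
  rfl

theorem arit_apply (A B : ARI) (r : ℕ) :
    arit B A r = aritDerivation ℚ (mouldSeries (id : RatFun r → RatFun r) B) (mouldSeries id A)
      (genericWord r) := by
  have length_word : (genericWord r).length = r := List.length_ofFn
  rw [aritDerivation_apply, LieRing.of_associative_ring_bracket, contract_sub,
    NCPowerSeries.sub_apply, contract_mul_letters_one, contract_letters_one_mul,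
    ← sum_range_Ioo_eq_sumSplits, ← sum_Icc_Ioc_eq_sumSplits, length_word, arit]
  · simp only [mouldSeries_id_apply]
    congr 1 <;> refine Finset.sum_congr rfl fun k hk => Finset.sum_congr rfl fun l hl => ?_
    · rw [if_neg]
      rw [List.drop_eq_nil_iff, length_word, not_le]
      exact (Finset.mem_Ioo.1 hl).2
    · rw [if_neg]
      rw [← List.length_eq_zero_iff, List.length_take, length_word]
      have := Finset.mem_Icc.1 hk
      omega
  · intro a c
    rw [mouldSeries_id_apply B, atWord_nil, mul_zero, ite_self]
  · exact fun b c => if_pos rfl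
  · intro a c
    rw [mouldSeries_id_apply B, atWord_nil, mul_zero, ite_self]
  · exact fun a b => if_pos rfl

theorem pullback_mouldSeries {α K : Type} [Field K] [Algebra ℚ K] (s : α → K) (A : Mould) :
    pullback s (AlgHom.id ℚ K) 1 (mouldSeries id A) = mouldSeries s A := by
  ext w
  rw [pullback_id_one_apply, mouldSeries_id_apply, mouldSeries_apply]

theorem ari_apply (A B : ARI) (r : ℕ) :
    ari A B r = (aritDerivation ℚ (mouldSeries (genericSum r) B) (mouldSeries (genericSum r) A) -
      aritDerivation ℚ (mouldSeries (genericSum r) A) (mouldSeries (genericSum r) B) +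
      ⁅mouldSeries (genericSum r) A, mouldSeries (genericSum r) B⁆) (genericLetters r) := by
  rw [← pullback_mouldSeries _ A, ← pullback_mouldSeries _ B, ← pullback_aritDerivation,
    ← pullback_aritDerivation, LieRing.of_associative_ring_bracket, ← map_mul, ← map_mul,
    ← map_sub, ← map_sub, ← map_add]
  rw [pullback_id_one_apply, map_genericLetters, NCPowerSeries.add_apply, NCPowerSeries.sub_apply,
    NCPowerSeries.sub_apply, ← mu_apply, ← mu_apply, ← arit_apply, ← arit_apply]
  rfl

end Ari

section DerivationMoulds

variable {D E : DerAB}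

theorem Da_lie_apply_genA (hD : D ∈ derLieC) (hE : E ∈ derLieC) :
    Da (⁅D, E⁆ genA) = ⁅Da (D genA), Da (E genA)⁆ := by
  ext r
  set A := mouldSeries (genericSum r) (Da (D genA))
  set B := mouldSeries (genericSum r) (Da (E genA))
  set G := aritDerivation ℚ B A - aritDerivation ℚ A B + ⁅A, B⁆ with G_def
  suffices h : mouldSeries (genericSum r) (Da (⁅D, E⁆ genA)) = G by
    rw [← mouldSeries_genericLetters (Da (⁅D, E⁆ genA) : Mould), h]
    exact (ari_apply _ _ r).symm
  refine sub_eq_zero.1 (eq_zero_of_weightDerivation_eq_zero genericSum_ne_zero ?_ ?_)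
  · rw [map_sub, weightDerivation_mouldSeries_Da genericSum_ne_zero, sub_eq_zero]
    exact seriesLieHom_partC_lie_apply genericSum_ne_zero hD hE
      (weightDerivation_mouldSeries_Da genericSum_ne_zero _)
      (weightDerivation_mouldSeries_Da genericSum_ne_zero _)
  · rw [G_def, NCPowerSeries.sub_apply, NCPowerSeries.add_apply, NCPowerSeries.sub_apply,
      aritDerivation_apply_nil, aritDerivation_apply_nil, lie_apply_nil, mouldSeries_apply,
      List.map_nil, atWord_nil, sub_zero, add_zero, sub_zero]

theorem eq_zero_of_seriesLieHom_genericSum_eq_zero {Q : LieC}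
    (hQ : ∀ r, seriesLieHom (genericSum r) Q = 0) : Q = 0 := by
  refine expandLieHom_injective (maPoly_injective ?_)
  rw [map_zero, map_zero]
  ext r
  have coeff_eq_zero := congrFun (hQ r) (genericLetters r)
  rw [seriesLieHom_apply, map_genericLetters, ← maPoly_apply] at coeff_eq_zero
  refine (mul_eq_zero.1 coeff_eq_zero).resolve_left (inv_ne_zero ?_)
  rw [← map_genericLetters]
  exact List.prod_ne_zero (by simpa using fun x _ => genericSum_ne_zero x)

theorem partC_eq_zero_of_Da_eq_zero {P : LieAB} (hP : Da P = 0) : partC P = 0 := by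
  refine eq_zero_of_seriesLieHom_genericSum_eq_zero fun r => ?_
  rw [← weightDerivation_mouldSeries_Da genericSum_ne_zero, hP]
  ext w
  rw [weightDerivation_apply, mouldSeries_apply, NCPowerSeries.zero_apply]
  exact mul_eq_zero_of_right _ (evalRat_zero _)

theorem shiftC_injective : Function.Injective shiftC := by
  refine (injective_iff_map_eq_zero shiftC).2 fun Q hQ => ?_
  refine eq_zero_of_seriesLieHom_genericSum_eq_zero fun r => ?_
  refine eq_zero_of_weightDerivation_eq_zero genericSum_ne_zero ?_ (seriesLieHom_apply_nil _ Q)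
  rw [← neg_eq_zero, ← seriesLieHom_shiftC, hQ, map_zero]

theorem eq_zero_of_Da_apply_genA_eq_zero (hD : D ∈ derLieC) (h : Da (D genA) = 0) : D = 0 := by
  have D_genA : D genA = 0 := by
    rw [← inclC_partC_apply hD, partC_eq_zero_of_Da_eq_zero h, map_zero]
  have partC_D_genB : partC (D genB) = 0 := by
    refine shiftC_injective (inclC_injective ?_)
    rw [← genA_lie_inclC, inclC_partC_apply hD, map_zero, map_zero, ← hD.1,
      LieDerivation.apply_lie_eq_add, D_genA, zero_lie, add_zero]
  refine LieDerivation.ext_of_lieSpan_eq_top _ lieSpan_range_freeLieAlgebra_of ?_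
  rintro _ ⟨_ | _, rfl⟩
  · exact D_genA
  · exact (inclC_partC_apply hD genB).symm.trans (partC_D_genB ▸ map_zero inclC)

end DerivationMoulds

section Eps

theorem ma_adA_genB (n : ℕ) : ma (adA n genB) = maWord [n] := by
  have expandC_of : expandC (.of ℚ n) = .single (FreeMonoid.ofList [n]) 1 :=
    FreeLieAlgebra.lift_of_apply _ n
  rw [ma, LinearMap.comp_apply, LinearMap.comp_apply, partC_adA_genB, expandC_of, maPoly_single]

theorem Da_adA_genB (n : ℕ) : Da (adA n genB) = (-1 : ℚ) ^ n • mouldU (n - 2) := by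
  ext r
  change (if r = 0 then 0 else ma (adA n genB) r / Delta r) =
    (-1 : ℚ) ^ n • (Pi.single 1 (var 0 ^ (n - 2 : ℤ)) : Mould) r
  rw [ma_adA_genB]
  rcases eq_or_ne r 1 with rfl | hr
  · have var_ne_zero : (var 0 : RatFun 1) ≠ 0 := genericSum_ne_zero (.of 0)
    rw [if_neg one_ne_zero, Pi.single_eq_same, zpow_sub₀ var_ne_zero, Algebra.smul_def]
    simp [maWord, Delta, mul_div_assoc, pow_two]
  · rw [maWord, Pi.single_eq_of_ne (by exact hr), Pi.single_eq_of_ne hr, zero_div, ite_self,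
      smul_zero]

theorem eps_genA (i : ℕ) : eps i genA = adA (2 * i) genB := freeDerivation_of _ _

theorem eps_genB (i : ℕ) : eps i genB =
    ∑ j ∈ Finset.range i, (-1 : ℚ) ^ j • ⁅adA j genB, adA (2 * i - 1 - j) genB⁆ :=
  freeDerivation_of _ _

theorem genA_lie_sum_adA {n m : ℕ} (hm : m ≤ n) :
    ⁅genA, ∑ j ∈ Finset.range m, (-1 : ℚ) ^ j • ⁅adA j genB, adA (n - 1 - j) genB⁆⁆ =
      ⁅genB, adA n genB⁆ - (-1 : ℚ) ^ m • ⁅adA m genB, adA (n - m) genB⁆ := by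
  induction m with
  | zero =>
    rw [Finset.sum_range_zero, lie_zero, pow_zero, one_smul, adA_zero, Nat.sub_zero, sub_self]
  | succ m ih =>
    rw [Finset.sum_range_succ, lie_add, ih (by omega), lie_smul, leibniz_lie, ← adA_succ,
      ← adA_succ, show n - 1 - m + 1 = n - m by omega, show n - 1 - m = n - (m + 1) by omega,
      pow_succ, smul_add, mul_neg_one, neg_smul]
    abel

theorem eps_lie_genA_genB (i : ℕ) : eps i ⁅genA, genB⁆ = 0 := by
  rw [LieDerivation.apply_lie_eq_add, eps_genA, eps_genB, genA_lie_sum_adA (by omega),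
    show 2 * i - i = i by omega, lie_self, smul_zero, sub_zero, ← lie_skew, neg_add_cancel]

theorem eps_mem_derLieC (i : ℕ) : eps i ∈ derLieC := by
  refine ⟨eps_lie_genA_genB i, coeffA_lieDerivation_apply ?_ ?_⟩
  · rw [eps_genA, coeffA_adA_genB]
  · simp only [eps_genB, map_sum, map_smul, coeffA_lie, smul_zero, Finset.sum_const_zero]

theorem eps_mem_derZero (i : ℕ) : eps i ∈ derZero := mem_derZero_of_mem_derLieC (eps_mem_derLieC i)

theorem Psi_eps (i : ℕ) : Psi ⟨eps i, eps_mem_derZero i⟩ = mouldU (2 * (i : ℤ) - 2) := by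
  refine (congrArg Da (eps_genA i)).trans ?_
  rw [Da_adA_genB, pow_mul, neg_one_sq, one_pow, one_smul, Nat.cast_mul, Nat.cast_two]

end Eps

section BracketPreserving

theorem range_eq_sInf_of_map_lie {ι R L V : Type*} [CommRing R] [LieRing L] [LieAlgebra R L]
    [AddCommGroup V] [Module R V] [Bracket V V] {g : ι → L}
    {f : LieSubalgebra.lieSpan R L (Set.range g) →ₗ[R] V} (map_lie : ∀ x y, f ⁅x, y⁆ = ⁅f x, f y⁆) :
    LinearMap.range f =
      sInf {W | (∀ i, f ⟨g i, LieSubalgebra.subset_lieSpan ⟨i, rfl⟩⟩ ∈ W) ∧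
        ∀ x ∈ W, ∀ y ∈ W, ⁅x, y⁆ ∈ W} := by
  refine le_antisymm (le_sInf ?_) (sInf_le ⟨fun i => ⟨_, rfl⟩, ?_⟩)
  · rintro W ⟨generators_mem, lie_mem⟩ _ ⟨⟨x, hx⟩, rfl⟩
    induction hx using LieSubalgebra.lieSpan_induction with
    | mem x hx =>
      obtain ⟨i, rfl⟩ := hx
      exact generators_mem i
    | zero => exact (map_zero f).symm ▸ zero_mem W
    | add x y hx hy ihx ihy => exact (map_add f ⟨x, hx⟩ ⟨y, hy⟩).symm ▸ add_mem ihx ihy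
    | smul c x hx ihx => exact (map_smul f c ⟨x, hx⟩).symm ▸ W.smul_mem c ihx
    | lie x y hx hy ihx ihy => exact (map_lie ⟨x, hx⟩ ⟨y, hy⟩).symm ▸ lie_mem _ ihx _ ihy
  · rintro _ ⟨x, rfl⟩ _ ⟨y, rfl⟩
    exact ⟨⁅x, y⁆, map_lie x y⟩

theorem isLieAlgebra_of_surjective {L V : Type} [LieRing L] [LieAlgebra ℚ L] [AddCommGroup V]
    [Module ℚ V] [Bracket V V] {f : L →ₗ[ℚ] V} (hf : Function.Surjective f)
    (map_lie : ∀ x y, f ⁅x, y⁆ = ⁅f x, f y⁆) : IsLieAlgebra V where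
  add_lie := by simp only [hf.forall, ← map_lie, ← map_add, add_lie, implies_true]
  lie_add := by simp only [hf.forall, ← map_lie, ← map_add, lie_add, implies_true]
  smul_lie c := by simp only [hf.forall, ← map_lie, ← map_smul, smul_lie, implies_true]
  lie_smul c := by simp only [hf.forall, ← map_lie, ← map_smul, lie_smul, implies_true]
  lie_self := by simp only [hf.forall, ← map_lie, lie_self, map_zero, implies_true]
  leibniz_lie := by
    simp only [hf.forall, ← map_lie, ← map_add]
    exact fun x y z => congrArg f (leibniz_lie x y z)

end BracketPreserving

section Pollack

theorem pollack_le_derLieC : pollack ≤ derLieC := by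
  rw [pollack, LieSubalgebra.lieSpan_le]
  rintro _ ⟨i, rfl⟩
  exact eps_mem_derLieC i

theorem pollack_le_derZero : pollack.toSubmodule ≤ derZero :=
  fun _ hD => mem_derZero_of_mem_derLieC (pollack_le_derLieC hD)

/-- The restriction of `Ψ` to Pollack's Lie algebra. -/
def pollackPsi : pollack →ₗ[ℚ] ARI := Psi ∘ₗ Submodule.inclusion pollack_le_derZero

theorem pollackPsi_lie (D E : pollack) : pollackPsi ⁅D, E⁆ = ⁅pollackPsi D, pollackPsi E⁆ :=
  Da_lie_apply_genA (pollack_le_derLieC D.2) (pollack_le_derLieC E.2)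

theorem pollackPsi_injective : Function.Injective pollackPsi :=
  (injective_iff_map_eq_zero pollackPsi).2 fun D hD =>
    Subtype.ext (eq_zero_of_Da_apply_genA_eq_zero (pollack_le_derLieC D.2) hD)

theorem range_pollackPsi : LinearMap.range pollackPsi = algU := by
  refine (range_eq_sInf_of_map_lie pollackPsi_lie).trans ?_
  rw [algU]
  congr! 4 with V
  constructor
  · intro h i hi
    obtain ⟨n, rfl⟩ : ∃ n : ℕ, i = n - 1 := ⟨(i + 1).toNat, by omega⟩
    rw [mul_sub, mul_one, ← Psi_eps]
    exact h n
  · intro h i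
    have := h (i - 1) (by omega)
    rw [mul_sub, mul_one, ← Psi_eps] at this
    exact this

theorem mouldU_mem_algU (i : ℕ) : mouldU (2 * (i : ℤ) - 2) ∈ algU := by
  rw [← range_pollackPsi, ← Psi_eps]
  exact ⟨⟨eps i, LieSubalgebra.subset_lieSpan ⟨i, rfl⟩⟩, rfl⟩

/-- The isomorphism of Pollack's Lie algebra with `𝒰` given by `Ψ`. -/
def pollackEquiv : pollack ≃ₗ[ℚ] algU :=
  (LinearEquiv.ofInjective pollackPsi pollackPsi_injective).trans
    (LinearEquiv.ofEq _ _ range_pollackPsi)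

theorem pollackEquiv_apply (D : pollack) :
    (pollackEquiv D : ARI) = Psi ⟨D, pollack_le_derZero D.2⟩ := rfl

theorem pollackEquiv_lie (D E : pollack) :
    pollackEquiv ⁅D, E⁆ = ⁅pollackEquiv D, pollackEquiv E⁆ :=
  Subtype.ext (pollackPsi_lie D E)

theorem isLieAlgebra_algU : IsLieAlgebra algU :=
  isLieAlgebra_of_surjective (f := pollackEquiv.toLinearMap) pollackEquiv.surjective
    pollackEquiv_lie

end Pollack

end EllipticMould

end

theorem mainTheorem4 :
    (∀ i : ℕ, ∃ h : EllipticMould.eps i ∈ EllipticMould.derZero,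
      EllipticMould.Psi ⟨EllipticMould.eps i, h⟩ = EllipticMould.mouldU (2 * (i : ℤ) - 2) ∧
        EllipticMould.mouldU (2 * (i : ℤ) - 2) ∈ EllipticMould.algU) ∧
    ∃ hE : ∀ D ∈ EllipticMould.pollack, D ∈ EllipticMould.derZero,
      EllipticMould.IsLieAlgebra EllipticMould.algU ∧
      ∃ e : EllipticMould.pollack ≃ₗ[ℚ] EllipticMould.algU,
        (∀ D : EllipticMould.pollack,
          ((e D : EllipticMould.algU) : EllipticMould.ARI) =
            EllipticMould.Psi ⟨(D : EllipticMould.DerAB), hE D D.2⟩) ∧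
        ∀ D₁ D₂ : EllipticMould.pollack, e ⁅D₁, D₂⁆ = ⁅e D₁, e D₂⁆ :=
  ⟨fun i => ⟨EllipticMould.eps_mem_derZero i, EllipticMould.Psi_eps i,
      EllipticMould.mouldU_mem_algU i⟩,
    fun _ hD => EllipticMould.pollack_le_derZero hD, EllipticMould.isLieAlgebra_algU,
    EllipticMould.pollackEquiv, EllipticMould.pollackEquiv_apply, EllipticMould.pollackEquiv_lie⟩
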